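/- Let $\theta>0$, let $p\in(0,1)$, and let $\varphi:[0,1]\to[0,1]$ be an absolutely continuous warping function, i.e. a (strictly) increasing, absolutely continuous function with $\varphi(0)=0$ and $\varphi(1)=1$; let $\varphi^{-1}$ be its inverse. Write $\|f\|^2=\int_0^1 f(t)^2\,\mathrm{d}t$. For $n\ge 1$ let $U_1,\dots,U_n$ be independent and uniformly distributed on $[0,1]$, let $U_1^\ast\le\dots\le U_n^\ast$ be the sorted sample, $U_0^\ast=0$, $U_{n+1}^\ast=1$, and $U^\ast=(U_0^\ast,\dots,U_{n+1}^\ast)$. BK algorithm. Conditionally on $U^\ast$, let $(\alpha_1,\dots,\alpha_{n+1})$ have the Dirichlet distribution with parameters $\theta(\varphi(U_j^\ast)-\varphi(U_{j-1}^\ast))$, $1\le j\le n+1$; put $\alpha_0=0$ and $\tilde\alpha_i=\sum_{j=0}^i\alpha_j$. The path $w_n^{\mathrm{BK}}(\cdot;\theta)$ is the linear interpolation of the points $(U_i^\ast,\tilde\alpha_i)$, $0\le i\le n+1$: for $t\in[0,1)$, $$w_n^{\mathrm{BK}}(t;\theta)=\sum_{j=0}^n\Bigl(\tilde\alpha_j+\alpha_{j+1}\frac{t-U_j^\ast}{U_{j+1}^\ast-U_j^\ast}\Bigr)\mathbf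 1_{[U_j^\ast,U_{j+1}^\ast)}(t),\qquad w_n^{\mathrm{BK}}(1;\theta)=1.$$ CDF algorithm. Independently of $U^\ast$, let $(\beta_1,\dots,\beta_n)$ have the Dirichlet distribution with parameters $(\theta/n,\dots,\theta/n)$; put $\beta_{-1}=\beta_0=\beta_{n+1}=0$, $\gamma_{j,p}=(1-p)\beta_j+p\beta_{j-1}$ for $0\le j\le n+1$, and $\tilde\gamma_{i,p}=\sum_{j=0}^i\gamma_{j,p}$. The path $w_n^{\mathrm{CDF}}(\cdot;\theta,p)$ is the linear interpolation of the points $(\varphi^{-1}(U_i^\ast),\tilde\gamma_{i,p})$, $0\le i\le n+1$: for $t\in[0,1)$, $$w_n^{\mathrm{CDF}}(t;\theta,p)=\sum_{j=0}^n\Bigl(\tilde\gamma_{j,p}+\gamma_{j+1,p}\frac{t-\varphi^{-1}(U_j^\ast)}{\varphi^{-1}(U_{j+1}^\ast)-\varphi^{-1}(U_j^\ast)}\Bigr)\mathbf 1_{[\varphi^{-1}(U_j^\ast),\varphi^{-1}(U_{j+1}^\ast))}(t),\qquad w_n^{\mathrm{CDF}}(1;\theta,p)=1.$$ Then, for every $n\ge1$,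 both $L^2$ risks below are well defined and finite (almost surely the path minus $\varphi$ lies in $L^2([0,1])$, and its squared norm is integrable), and as $n\to\infty$ $$\mathbb E\bigl[\|w_n^{\mathrm{BK}}(\cdot;\theta)-\varphi\|^2\bigr]\to\frac1{1+\theta}\int_0^1\varphi(t)(1-\varphi(t))\,\mathrm{d}t \quad\text{and}\quad \mathbb E\bigl[\|w_n^{\mathrm{CDF}}(\cdot;\theta,p)-\varphi\|^2\bigr]\to\frac1{1+\theta}\int_0^1\varphi(t)(1-\varphi(t))\,\mathrm{d}t.$$ -/

import Mathlib

open MeasureTheory ProbabilityTheory Filter Topology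

/-- An absolutely continuous warping function of `[0,1]`: a (strictly) increasing continuous
function with `φ 0 = 0` and `φ 1 = 1` (hence a bijection of `[0,1]`), which is absolutely continuous
on `[0,1]`. Only the values of `φ` on `[0,1]` matter. -/
structure IsACWarping (φ : ℝ → ℝ) : Prop where
  map_zero : φ 0 = 0
  map_one : φ 1 = 1
  strictMonoOn : StrictMonoOn φ (Set.Icc 0 1)
  continuousOn : ContinuousOn φ (Set.Icc 0 1)
  absolutelyContinuous : AbsolutelyContinuousOnInterval φ 0 1

/-- The inverse `φ⁻¹ : [0,1] → [0,1]` of a warping function. -/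
noncomputable def warpInv (φ : ℝ → ℝ) : ℝ → ℝ :=
  Function.invFunOn φ (Set.Icc 0 1)

/-- The squared `L²([0,1])` norm `‖f‖² = ⟨f, f⟩ = ∫₀¹ f(t) f(t) dt`. -/
noncomputable def l2NormSq (f : ℝ → ℝ) : ℝ :=
  ∫ t in (0 : ℝ)..1, f t * f t

/-- The Dirichlet distribution with (positive) parameters `a`: the law of `G / ∑ j, G j`, where the
`G i` are independent Gamma random variables with shapes `a i` and rate `1`. -/
noncomputable def dirichletMeasure {ι : Type*} [Fintype ι] (a : ι → ℝ) : Measure (ι → ℝ) :=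
  (Measure.pi fun i => gammaMeasure (a i) 1).map fun x i => x i / ∑ j, x j

/-- The vector `U* = (0, U*₁, …, U*ₙ, 1)`: the sorted sample, completed by `U*₀ = 0` and
`U*ₙ₊₁ = 1`. -/
noncomputable def sortedKnots {n : ℕ} (u : Fin n → ℝ) : Fin (n + 2) → ℝ :=
  Fin.cons (α := fun _ => ℝ) 0 (Fin.snoc (α := fun _ => ℝ) (u ∘ Tuple.sort u) 1)

/-- The cumulative sums `ã i = a 0 + … + a i`. -/
noncomputable def cumSum {m : ℕ} (a : Fin m → ℝ) (i : Fin m) : ℝ :=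
  ∑ j ∈ Finset.Iic i, a j

/-- The path which at abscissa `x j` takes the value `ã j` (the cumulative sum of the jumps `a`),
interpolated linearly in between, with value `1` at `t = 1`. -/
noncomputable def interpPath {n : ℕ} (x a : Fin (n + 2) → ℝ) (t : ℝ) : ℝ :=
  if t = 1 then 1 else
    ∑ j : Fin (n + 1), (Set.Ico (x j.castSucc) (x j.succ)).indicator
      (fun s => cumSum a j.castSucc
        + a j.succ * ((s - x j.castSucc) / (x j.succ - x j.castSucc))) t

/-- The parameters `θ (φ(x (j+1)) - φ(x j))`, for `0 ≤ j ≤ n`, of the Dirichlet vector of the BK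
algorithm. -/
noncomputable def bkParam {n : ℕ} (θ : ℝ) (φ : ℝ → ℝ) (x : Fin (n + 2) → ℝ) : Fin (n + 1) → ℝ :=
  fun j => θ * (φ (x j.succ) - φ (x j.castSucc))

/-- The random inputs of the BK algorithm: an `n`-sample `U` of the uniform distribution on `[0,1]`
and a random vector `α = (α₁, …, αₙ₊₁)` which, conditionally on `U*`, has the Dirichlet distribution
with parameters `θ (φ(U*ⱼ) - φ(U*ⱼ₋₁))`, `1 ≤ j ≤ n + 1`. -/
structure IsBKSample {Ω : Type*} [MeasurableSpace Ω] (P : Measure Ω) [IsFiniteMeasure P]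
    {n : ℕ} (θ : ℝ) (φ : ℝ → ℝ) (U : Fin n → Ω → ℝ) (α : Ω → Fin (n + 1) → ℝ) : Prop where
  indep : iIndepFun U P
  uniform : ∀ i, HasLaw (U i) (volume.restrict (Set.Icc (0 : ℝ) 1)) P
  aemeasurable : AEMeasurable α P
  dirichlet : ∀ᵐ x ∂(P.map fun ω => sortedKnots fun i => U i ω),
    condDistrib α (fun ω => sortedKnots fun i => U i ω) P x = dirichletMeasure (bkParam θ φ x)

/-- The path of the BK algorithm: the linear interpolation of the points `(U*ᵢ, α̃ᵢ)`, with
`α₀ = 0`. -/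
noncomputable def bkPath {n : ℕ} (u : Fin n → ℝ) (α : Fin (n + 1) → ℝ) : ℝ → ℝ :=
  interpPath (sortedKnots u) (Fin.cons (α := fun _ => ℝ) 0 α)

/-- The random inputs of the CDF algorithm: an `n`-sample `U` of the uniform distribution on `[0,1]`
and, independently of `U*`, a random vector `β = (β₁, …, βₙ)` having the Dirichlet distribution
with parameters `(θ/n, …, θ/n)`. -/
structure IsCDFSample {Ω : Type*} [MeasurableSpace Ω] (P : Measure Ω)
    {n : ℕ} (θ : ℝ) (U : Fin n → Ω → ℝ) (β : Ω → Fin n → ℝ) : Prop where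
  indep : iIndepFun U P
  uniform : ∀ i, HasLaw (U i) (volume.restrict (Set.Icc (0 : ℝ) 1)) P
  dirichlet : HasLaw β (dirichletMeasure fun _ => θ / n) P
  indep_dirichlet : IndepFun (fun ω => sortedKnots fun i => U i ω) β P

/-- The sequence `βₖ`, `k ∈ ℤ`, extending `(β₁, …, βₙ)` by `0`; in particular
`β₋₁ = β₀ = βₙ₊₁ = 0`. -/
noncomputable def extendZero {n : ℕ} (β : Fin n → ℝ) (k : ℤ) : ℝ :=
  if h : 1 ≤ k ∧ k ≤ n then β ⟨(k - 1).toNat, by omega⟩ else 0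

/-- The vector `γ j = (1 - p) βⱼ + p βⱼ₋₁`, for `0 ≤ j ≤ n + 1`. -/
noncomputable def cdfJumps {n : ℕ} (p : ℝ) (β : Fin n → ℝ) : Fin (n + 2) → ℝ :=
  fun j => (1 - p) * extendZero β ((j : ℕ) : ℤ) + p * extendZero β (((j : ℕ) : ℤ) - 1)

/-- The path of the CDF algorithm: the linear interpolation of the points `(φ⁻¹(U*ᵢ), γ̃ᵢ)`. -/
noncomputable def cdfPath {n : ℕ} (p : ℝ) (φ : ℝ → ℝ) (u β : Fin n → ℝ) : ℝ → ℝ :=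
  interpPath (fun i => warpInv φ (sortedKnots u i)) (cdfJumps p β)

/-! Freeze the knots and a time `t`. In both algorithms the value of the path at `t` is a partial
sum of a Dirichlet vector of total mass `θ`, up to an interpolation error controlled by one or two
of its coordinates. A partial sum whose parameters make up the fraction `m` of the total mass has
mean `m` and variance `m (1 - m) / (1 + θ)`. If `m` is close to `φ t` and the coordinates in the
error carry little mass, the mean squared deviation from `φ t` is therefore close to `φ t (1 - φ t)
/ (1 + θ)`; Fubini and integration over `t` give the limit. This is `abs_integral_l2NormSq_sub_le`.

Both smallness conditions hold once the sorted sample is uniformly close to the grid `j / n`. For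
BK, `m = φ (U*ⱼ)` with `t` in the cell that starts at `U*ⱼ`, and uniform continuity of `φ` concludes
(`bk_path_close`). For CDF, `m = j / n`, and `φ t` lies between `U*ⱼ` and `U*ⱼ₊₁`, so closeness to
the grid is enough (`cdf_path_close`).

The sample fails to be close to the grid with probability `O(1 / n)`, by Chebyshev's inequality at
finitely many points (`measure_not_close_le`). There the risk and its limit both lie in `[0, 1]`, so
the loss is at most that probability (`abs_integral_compProd_sub_le`).
`IsPathScheme.abs_risk_sub_le` assembles these estimates for both algorithms at once.

The Dirichlet moments come from independent Gamma variables: a power of the random total in the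
denominator is written as a Laplace integral, under which the coordinates become independent again.
-/

/-! ### Moments of the Dirichlet distribution -/

section GammaMoments

theorem ae_pos_gammaMeasure {a r : ℝ} : ∀ᵐ x ∂(gammaMeasure a r), 0 < x := by
  rw [gammaMeasure, ae_withDensity_iff (by unfold gammaPDF; fun_prop)]
  have h0 : ∀ᵐ x : ℝ, x ≠ 0 := by simp [ae_iff]
  filter_upwards [h0] with x hx0 hx
  by_contra h
  exact hx (gammaPDF_of_neg (lt_of_le_of_ne (not_lt.mp h) hx0))

theorem integrable_gammaPDFReal {a r : ℝ} (ha : 0 < a) (hr : 0 < r) :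
    Integrable (gammaPDFReal a r) := by
  refine ⟨by fun_prop, ?_⟩
  rw [hasFiniteIntegral_iff_ofReal (ae_of_all _ (gammaPDFReal_nonneg ha hr))]
  have := lintegral_gammaPDF_eq_one ha hr
  simp only [gammaPDF] at this
  simp [this]

theorem integral_gammaPDFReal {a r : ℝ} (ha : 0 < a) (hr : 0 < r) :
    ∫ x, gammaPDFReal a r x = 1 := by
  rw [integral_eq_lintegral_of_nonneg_ae (ae_of_all _ (gammaPDFReal_nonneg ha hr)) (by fun_prop)]
  have := lintegral_gammaPDF_eq_one ha hr
  simp only [gammaPDF] at this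
  simp [this]

/-- Exponential tilting stays inside the Gamma family, with shape `a + c` and rate `1 + l`. All
tilted moments thus reduce to the total mass of a Gamma density. -/
theorem gammaPDFReal_mul_tilt {a l : ℝ} (ha : 0 < a) (hl : 0 ≤ l) (c : ℕ) {x : ℝ} (hx : x ≠ 0) :
    gammaPDFReal a 1 x * (x ^ c * Real.exp (-(l * x)))
      = Real.Gamma (a + c) / Real.Gamma a * (1 + l) ^ (-(a + c))
        * gammaPDFReal (a + c) (1 + l) x := by
  unfold gammaPDFReal
  split_ifs with h
  · have hx0 : 0 < x := lt_of_le_of_ne h hx.symm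
    have hG := (Real.Gamma_pos_of_pos ha).ne'
    have hac : 0 < a + c := by positivity
    have hG2 := (Real.Gamma_pos_of_pos hac).ne'
    have h1 : (1 + l) ^ (-(a + c)) * (1 + l) ^ (a + c) = 1 := by
      rw [← Real.rpow_add (by positivity)]; simp
    have h2 : x ^ (a + c - 1) = x ^ (a - 1) * x ^ c := by
      rw [← Real.rpow_natCast x c, ← Real.rpow_add hx0]; ring_nf
    have h3 : Real.exp (-((1 + l) * x)) = Real.exp (-(1 * x)) * Real.exp (-(l * x)) := by
      rw [← Real.exp_add]; ring_nf
    rw [h2, h3, Real.one_rpow]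
    have : Real.Gamma (a + c) / Real.Gamma a * (1 + l) ^ (-(a + c)) *
        ((1 + l) ^ (a + c) / Real.Gamma (a + c) * (x ^ (a - 1) * x ^ c)
          * (Real.exp (-(1 * x)) * Real.exp (-(l * x))))
        = ((1 + l) ^ (-(a + c)) * (1 + l) ^ (a + c)) * (Real.Gamma (a + c) / Real.Gamma (a + c))
          * (1 / Real.Gamma a * (x ^ (a - 1) * x ^ c)
          * (Real.exp (-(1 * x)) * Real.exp (-(l * x)))) := by ring
    rw [this, h1, div_self hG2]; ring
  · simp

theorem ae_gammaPDFReal_mul_tilt {a l : ℝ} (ha : 0 < a) (hl : 0 ≤ l) (c : ℕ) :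
    (fun x => gammaPDFReal a 1 x * (x ^ c * Real.exp (-(l * x)))) =ᵐ[volume]
      fun x => Real.Gamma (a + c) / Real.Gamma a * (1 + l) ^ (-(a + c))
        * gammaPDFReal (a + c) (1 + l) x := by
  have h0 : ∀ᵐ x : ℝ, x ≠ 0 := by simp [ae_iff]
  filter_upwards [h0] with x hx
  exact gammaPDFReal_mul_tilt ha hl c hx

theorem integrable_tilt_gammaMeasure {a l : ℝ} (ha : 0 < a) (hl : 0 ≤ l) (c : ℕ) :
    Integrable (fun x => x ^ c * Real.exp (-(l * x))) (gammaMeasure a 1) := by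
  rw [gammaMeasure, integrable_withDensity_iff_integrable_smul₀' (by unfold gammaPDF; fun_prop)
    (ae_of_all _ fun x => by simp [gammaPDF])]
  refine ((integrable_gammaPDFReal (a := a + c) (r := 1 + l) (by positivity)
    (by positivity)).const_mul _).congr
      ((ae_gammaPDFReal_mul_tilt ha hl c).symm.trans (ae_of_all _ fun x => ?_))
  simp [gammaPDF, ENNReal.toReal_ofReal (gammaPDFReal_nonneg ha one_pos x)]

theorem integral_tilt_gammaMeasure {a l : ℝ} (ha : 0 < a) (hl : 0 ≤ l) (c : ℕ) :
    ∫ x, x ^ c * Real.exp (-(l * x)) ∂(gammaMeasure a 1)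
      = Real.Gamma (a + c) / Real.Gamma a * (1 + l) ^ (-(a + c)) := by
  rw [gammaMeasure, integral_withDensity_eq_integral_toReal_smul₀ (by unfold gammaPDF; fun_prop)
    (ae_of_all _ fun x => by simp [gammaPDF])]
  have : ∀ x, (gammaPDF a 1 x).toReal • (x ^ c * Real.exp (-(l * x)))
      = gammaPDFReal a 1 x * (x ^ c * Real.exp (-(l * x))) := fun x => by
    simp [gammaPDF, ENNReal.toReal_ofReal (gammaPDFReal_nonneg ha one_pos x)]
  simp_rw [this]
  rw [integral_congr_ae (ae_gammaPDFReal_mul_tilt ha hl c), integral_const_mul,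
    integral_gammaPDFReal (by positivity) (by positivity), mul_one]

end GammaMoments

/-! ### First and second moments of partial sums of a Dirichlet vector. -/

section Dirichlet

variable {ι : Type*} [Fintype ι]

theorem isProbabilityMeasure_pi_gamma {a : ι → ℝ} (ha : ∀ i, 0 < a i) :
    IsProbabilityMeasure (Measure.pi fun i => gammaMeasure (a i) 1) := by
  have : ∀ i, IsProbabilityMeasure (gammaMeasure (a i) 1) :=
    fun i => isProbabilityMeasure_gammaMeasure (ha i) one_pos
  infer_instance

theorem ae_pos_pi_gamma {a : ι → ℝ} (ha : ∀ i, 0 < a i) :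
    ∀ᵐ x ∂(Measure.pi fun i => gammaMeasure (a i) 1), ∀ i, 0 < x i := by
  have : ∀ i, IsProbabilityMeasure (gammaMeasure (a i) 1) :=
    fun i => isProbabilityMeasure_gammaMeasure (ha i) one_pos
  rw [ae_all_iff]
  intro i
  have h := (measurePreserving_eval (fun i => gammaMeasure (a i) 1) i).quasiMeasurePreserving
  exact h.ae ae_pos_gammaMeasure

theorem prod_tilt (l : ℝ) (c : ι → ℕ) (x : ι → ℝ) :
    ∏ i, (x i ^ c i * Real.exp (-(l * x i)))
      = (∏ i, x i ^ c i) * Real.exp (-(l * ∑ i, x i)) := by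
  rw [Finset.prod_mul_distrib, ← Real.exp_sum, Finset.mul_sum, Finset.sum_neg_distrib]

theorem integrable_tilt_pi_gamma {a : ι → ℝ} (ha : ∀ i, 0 < a i) {l : ℝ} (hl : 0 ≤ l)
    (c : ι → ℕ) :
    Integrable (fun x : ι → ℝ => (∏ i, x i ^ c i) * Real.exp (-(l * ∑ i, x i)))
      (Measure.pi fun i => gammaMeasure (a i) 1) := by
  have : ∀ i, IsProbabilityMeasure (gammaMeasure (a i) 1) :=
    fun i => isProbabilityMeasure_gammaMeasure (ha i) one_pos
  simp_rw [← prod_tilt]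
  exact Integrable.fintype_prod (f := fun i x => x ^ c i * Real.exp (-(l * x)))
    fun i => integrable_tilt_gammaMeasure (ha i) hl (c i)

/-- The point is that the dependence on `l` involves only the total shape and the degree of the
monomial, not the monomial itself. -/
theorem integral_tilt_pi_gamma {a : ι → ℝ} (ha : ∀ i, 0 < a i) {l : ℝ} (hl : 0 ≤ l)
    (c : ι → ℕ) :
    ∫ x : ι → ℝ, (∏ i, x i ^ c i) * Real.exp (-(l * ∑ i, x i))
        ∂(Measure.pi fun i => gammaMeasure (a i) 1)
      = (∏ i, Real.Gamma (a i + c i) / Real.Gamma (a i))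
        * (1 + l) ^ (-((∑ i, a i) + (∑ i, c i : ℕ))) := by
  have : ∀ i, IsProbabilityMeasure (gammaMeasure (a i) 1) :=
    fun i => isProbabilityMeasure_gammaMeasure (ha i) one_pos
  simp_rw [← prod_tilt]
  rw [integral_fintype_prod_eq_prod (f := fun i x => x ^ c i * Real.exp (-(l * x)))]
  simp_rw [fun i => integral_tilt_gammaMeasure (ha i) hl (c i)]
  rw [Finset.prod_mul_distrib, ← Real.rpow_sum_of_pos (by positivity)]
  congr 2
  push_cast
  rw [Finset.sum_neg_distrib, Finset.sum_add_distrib]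

theorem integrable_coord_tilt {a : ι → ℝ} (ha : ∀ i, 0 < a i) {l : ℝ} (hl : 0 ≤ l) (i : ι) :
    Integrable (fun x : ι → ℝ => x i * Real.exp (-(l * ∑ k, x k)))
      (Measure.pi fun i => gammaMeasure (a i) 1) := by
  classical
  simpa [Pi.single_apply, Finset.prod_ite_eq', pow_ite] using
    integrable_tilt_pi_gamma ha hl (Pi.single i 1)

theorem integral_coord_tilt {a : ι → ℝ} (ha : ∀ i, 0 < a i) {l : ℝ} (hl : 0 ≤ l) (i : ι) :
    ∫ x : ι → ℝ, x i * Real.exp (-(l * ∑ k, x k)) ∂(Measure.pi fun i => gammaMeasure (a i) 1)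
      = a i * (1 + l) ^ (-((∑ i, a i) + 1)) := by
  classical
  have h := integral_tilt_pi_gamma ha hl (Pi.single i 1)
  have h1 : ∏ k, Real.Gamma (a k + (Pi.single i 1 : ι → ℕ) k) / Real.Gamma (a k) = a i := by
    rw [Finset.prod_eq_single i]
    · simp [Real.Gamma_add_one (ha i).ne', (Real.Gamma_pos_of_pos (ha i)).ne']
    · intro k _ hk
      simp [hk, (Real.Gamma_pos_of_pos (ha k)).ne']
    · simp
  rw [h1] at h
  simpa [Pi.single_apply, Finset.prod_ite_eq', pow_ite] using h

theorem prod_pow_single_add_single [DecidableEq ι] (x : ι → ℝ) (i j : ι) :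
    ∏ k, x k ^ (Pi.single i 1 + Pi.single j 1 : ι → ℕ) k = x i * x j := by
  simp_rw [Pi.add_apply, pow_add, Finset.prod_mul_distrib]
  simp [Pi.single_apply, pow_ite]

theorem integrable_coord_mul_tilt {a : ι → ℝ} (ha : ∀ i, 0 < a i) {l : ℝ} (hl : 0 ≤ l)
    (i j : ι) :
    Integrable (fun x : ι → ℝ => x i * x j * Real.exp (-(l * ∑ k, x k)))
      (Measure.pi fun i => gammaMeasure (a i) 1) := by
  classical
  refine (integrable_tilt_pi_gamma ha hl (Pi.single i 1 + Pi.single j 1)).congr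
    (ae_of_all _ fun x => ?_)
  dsimp only
  rw [prod_pow_single_add_single]

theorem integral_coord_mul_tilt [DecidableEq ι] {a : ι → ℝ} (ha : ∀ i, 0 < a i) {l : ℝ}
    (hl : 0 ≤ l) (i j : ι) :
    ∫ x : ι → ℝ, x i * x j * Real.exp (-(l * ∑ k, x k))
        ∂(Measure.pi fun i => gammaMeasure (a i) 1)
      = (a i * (a j + if i = j then 1 else 0)) * (1 + l) ^ (-((∑ i, a i) + 2)) := by
  have h := integral_tilt_pi_gamma ha hl (Pi.single i 1 + Pi.single j 1)
  have h1 : ∏ k, Real.Gamma (a k + (Pi.single i 1 + Pi.single j 1 : ι → ℕ) k) / Real.Gamma (a k)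
      = a i * (a j + if i = j then 1 else 0) := by
    have hG := fun k => (Real.Gamma_pos_of_pos (ha k)).ne'
    by_cases hij : i = j
    · subst hij
      rw [Finset.prod_eq_single i]
      · have h2 : a i + 1 ≠ 0 := by have := ha i; positivity
        have h3 : a i + ((1 + 1 : ℕ) : ℝ) = (a i + 1) + 1 := by push_cast; ring
        simp only [Pi.add_apply, Pi.single_eq_same, if_true]
        rw [h3, Real.Gamma_add_one h2, Real.Gamma_add_one (ha i).ne']
        field_simp [hG i]
      · intro k _ hk
        simp [hk, hG k]
      · simp
    · rw [Finset.prod_eq_mul i j hij]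
      · simp [hij, Ne.symm hij, Real.Gamma_add_one (ha i).ne', Real.Gamma_add_one (ha j).ne', hG]
      · intro k _ hk
        simp [hk.1, hk.2, hG k]
      · simp
      · simp
  have h2 : (∑ k, (Pi.single i 1 + Pi.single j 1 : ι → ℕ) k) = 2 := by
    simp [Finset.sum_add_distrib]
  rw [h1, h2] at h
  simpa only [prod_pow_single_add_single, Nat.cast_ofNat] using h

theorem integral_sum_tilt {a : ι → ℝ} (ha : ∀ i, 0 < a i) {l : ℝ} (hl : 0 ≤ l) (J : Finset ι) :
    Integrable (fun x : ι → ℝ => (∑ i ∈ J, x i) * Real.exp (-(l * ∑ k, x k)))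
      (Measure.pi fun i => gammaMeasure (a i) 1) ∧
    ∫ x : ι → ℝ, (∑ i ∈ J, x i) * Real.exp (-(l * ∑ k, x k))
        ∂(Measure.pi fun i => gammaMeasure (a i) 1)
      = (∑ i ∈ J, a i) * (1 + l) ^ (-((∑ i, a i) + 1)) := by
  simp_rw [Finset.sum_mul]
  refine ⟨integrable_finsetSum _ fun i _ => integrable_coord_tilt ha hl i, ?_⟩
  rw [integral_finsetSum _ fun i _ => integrable_coord_tilt ha hl i]
  exact Finset.sum_congr rfl fun i _ => integral_coord_tilt ha hl i

theorem integral_sum_sq_tilt {a : ι → ℝ} (ha : ∀ i, 0 < a i) {l : ℝ} (hl : 0 ≤ l)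
    (J : Finset ι) :
    Integrable (fun x : ι → ℝ => (∑ i ∈ J, x i) ^ 2 * Real.exp (-(l * ∑ k, x k)))
      (Measure.pi fun i => gammaMeasure (a i) 1) ∧
    ∫ x : ι → ℝ, (∑ i ∈ J, x i) ^ 2 * Real.exp (-(l * ∑ k, x k))
        ∂(Measure.pi fun i => gammaMeasure (a i) 1)
      = (∑ i ∈ J, a i) * ((∑ i ∈ J, a i) + 1) * (1 + l) ^ (-((∑ i, a i) + 2)) := by
  classical
  simp_rw [sq, Finset.sum_mul_sum, Finset.sum_mul]
  have hint := fun i => integrable_finsetSum J fun j _ => integrable_coord_mul_tilt ha hl i j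
  refine ⟨integrable_finsetSum _ fun i _ => hint i, ?_⟩
  rw [integral_finsetSum _ fun i _ => hint i]
  refine Finset.sum_congr rfl fun i hi => ?_
  rw [integral_finsetSum _ fun j _ => integrable_coord_mul_tilt ha hl i j]
  simp_rw [integral_coord_mul_tilt ha hl]
  rw [← Finset.sum_mul, ← Finset.mul_sum, Finset.sum_add_distrib]
  simp [hi]

/-- Integration of `q / S ^ k`, `S` the total mass, from the Laplace transforms of `q`. -/
theorem lintegral_div_pow_sum {a : ι → ℝ} (ha : ∀ i, 0 < a i) [Nonempty ι] {k : ℕ} (hk : 0 < k)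
    {q : (ι → ℝ) → ℝ} (hq : Measurable q) (hq0 : ∀ x, (∀ i, 0 < x i) → 0 ≤ q x) {B s : ℝ}
    (hB : 0 ≤ B)
    (h : ∀ l, 0 ≤ l →
      Integrable (fun x : ι → ℝ => q x * Real.exp (-(l * ∑ i, x i)))
        (Measure.pi fun i => gammaMeasure (a i) 1) ∧
      ∫ x : ι → ℝ, q x * Real.exp (-(l * ∑ i, x i)) ∂(Measure.pi fun i => gammaMeasure (a i) 1)
        = B * (1 + l) ^ s) :
    ∫⁻ x, ENNReal.ofReal (q x / (∑ i, x i) ^ k) ∂(Measure.pi fun i => gammaMeasure (a i) 1)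
      = ENNReal.ofReal B * ∫⁻ l in Set.Ici (0 : ℝ),
        ENNReal.ofReal (l ^ ((k : ℝ) - 1) / Real.Gamma k * (1 + l) ^ s) := by
  have := isProbabilityMeasure_pi_gamma ha
  set μ := Measure.pi fun i => gammaMeasure (a i) 1 with hμ
  have hk' : (0 : ℝ) < k := by exact_mod_cast hk
  have hG := Real.Gamma_pos_of_pos hk'
  calc ∫⁻ x, ENNReal.ofReal (q x / (∑ i, x i) ^ k) ∂μ
      = ∫⁻ x, (∫⁻ l in Set.Ici (0 : ℝ), ENNReal.ofReal (l ^ ((k : ℝ) - 1) / Real.Gamma k)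
          * ENNReal.ofReal (q x * Real.exp (-(l * ∑ i, x i)))) ∂μ := by
        refine lintegral_congr_ae ?_
        filter_upwards [ae_pos_pi_gamma ha] with x hx
        have hS : 0 < ∑ i, x i := Finset.sum_pos (fun i _ => hx i) Finset.univ_nonempty
        have hq1 := hq0 x hx
        -- With `S` the total, the Gamma density in `l` of shape `k` and rate `S` has mass one; this
        -- is `S ^ (-k) = ∫ l ^ (k - 1) e ^ (-l S) / Γ(k) dl`.
        have hg := lintegral_gammaPDF_eq_one hk' hS
        rw [← mul_one (ENNReal.ofReal _), ← hg, ← lintegral_const_mul _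
          (by unfold gammaPDF; fun_prop), ← lintegral_indicator measurableSet_Ici]
        refine lintegral_congr fun l => ?_
        by_cases hl : 0 ≤ l
        · rw [gammaPDF_of_nonneg hl, Set.indicator_of_mem (by simpa using hl),
            ← ENNReal.ofReal_mul (by positivity), ← ENNReal.ofReal_mul (by positivity)]
          congr 1
          rw [Real.rpow_natCast, mul_comm l]
          field_simp
        · rw [gammaPDF_of_neg (not_le.mp hl), Set.indicator_of_notMem (by simpa using hl)]
          simp
    _ = ∫⁻ l in Set.Ici (0 : ℝ), ∫⁻ x, ENNReal.ofReal (l ^ ((k : ℝ) - 1) / Real.Gamma k)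
          * ENNReal.ofReal (q x * Real.exp (-(l * ∑ i, x i))) ∂μ := by
        rw [lintegral_lintegral_swap]
        fun_prop
    _ = ∫⁻ l in Set.Ici (0 : ℝ), ENNReal.ofReal B *
          ENNReal.ofReal (l ^ ((k : ℝ) - 1) / Real.Gamma k * (1 + l) ^ s) := by
        refine setLIntegral_congr_fun measurableSet_Ici fun l (hl : 0 ≤ l) => ?_
        rw [lintegral_const_mul _ (by fun_prop), ← ofReal_integral_eq_lintegral_ofReal (h l hl).1
          (by filter_upwards [ae_pos_pi_gamma ha] with x hx using
            mul_nonneg (hq0 x hx) (Real.exp_pos _).le), (h l hl).2,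
          ENNReal.ofReal_mul hB, ENNReal.ofReal_mul (by positivity)]
        ring
    _ = _ := by rw [lintegral_const_mul _ (by fun_prop)]

/-- The integral over `l` is the same for every `J` and need not be computed: for `J = univ` the
integrand `q J / S ^ k` is `1`, so that integral is the inverse of `B univ`. -/
theorem lintegral_div_pow_sum_eq {a : ι → ℝ} (ha : ∀ i, 0 < a i) [Nonempty ι] {k : ℕ}
    (hk : 0 < k) {q : Finset ι → (ι → ℝ) → ℝ} {B : Finset ι → ℝ} {s : ℝ}
    (hq : ∀ J, Measurable (q J)) (hq0 : ∀ J x, (∀ i, 0 < x i) → 0 ≤ q J x)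
    (hq1 : ∀ x, q Finset.univ x = (∑ i, x i) ^ k) (hB : ∀ J, 0 ≤ B J)
    (hB1 : 0 < B Finset.univ)
    (h : ∀ J l, 0 ≤ l →
      Integrable (fun x : ι → ℝ => q J x * Real.exp (-(l * ∑ i, x i)))
        (Measure.pi fun i => gammaMeasure (a i) 1) ∧
      ∫ x : ι → ℝ, q J x * Real.exp (-(l * ∑ i, x i)) ∂(Measure.pi fun i => gammaMeasure (a i) 1)
        = B J * (1 + l) ^ s) (J : Finset ι) :
    ∫⁻ x, ENNReal.ofReal (q J x / (∑ i, x i) ^ k) ∂(Measure.pi fun i => gammaMeasure (a i) 1)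
      = ENNReal.ofReal (B J / B Finset.univ) := by
  have := isProbabilityMeasure_pi_gamma ha
  have e1 := lintegral_div_pow_sum ha hk (hq Finset.univ) (hq0 _) (hB _) (h Finset.univ)
  have e2 := lintegral_div_pow_sum ha hk (hq J) (hq0 _) (hB _) (h J)
  have e3 : ∫⁻ x, ENNReal.ofReal (q Finset.univ x / (∑ i, x i) ^ k)
      ∂(Measure.pi fun i => gammaMeasure (a i) 1) = 1 := by
    rw [lintegral_congr_ae (g := fun _ => 1)]
    · simp
    filter_upwards [ae_pos_pi_gamma ha] with x hx
    have hS : 0 < ∑ i, x i := Finset.sum_pos (fun i _ => hx i) Finset.univ_nonempty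
    rw [hq1, div_self (by positivity), ENNReal.ofReal_one]
  rw [e3] at e1
  rw [e2, div_eq_mul_inv, ENNReal.ofReal_mul (hB J), ENNReal.ofReal_inv_of_pos hB1]
  congr 1
  exact ENNReal.eq_inv_of_mul_eq_one_left (by rw [mul_comm]; exact e1.symm)

theorem measurable_normalize : Measurable fun (x : ι → ℝ) i => x i / ∑ j, x j := by fun_prop

theorem isProbabilityMeasure_dirichletMeasure {a : ι → ℝ} (ha : ∀ i, 0 < a i) :
    IsProbabilityMeasure (dirichletMeasure a) := by
  have := isProbabilityMeasure_pi_gamma ha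
  exact Measure.isProbabilityMeasure_map measurable_normalize.aemeasurable

theorem measurableSet_simplex :
    MeasurableSet {z : ι → ℝ | (∀ i, 0 ≤ z i) ∧ ∑ i, z i = 1} :=
  (isClosed_stdSimplex (𝕜 := ℝ) ι).measurableSet

theorem ae_dirichletMeasure {a : ι → ℝ} (ha : ∀ i, 0 < a i) [Nonempty ι] :
    ∀ᵐ z ∂(dirichletMeasure a), (∀ i, 0 ≤ z i) ∧ ∑ i, z i = 1 := by
  rw [dirichletMeasure, ae_map_iff measurable_normalize.aemeasurable measurableSet_simplex]
  filter_upwards [ae_pos_pi_gamma ha] with x hx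
  have hS : 0 < ∑ i, x i := Finset.sum_pos (fun i _ => hx i) Finset.univ_nonempty
  refine ⟨fun i => div_nonneg (hx i).le hS.le, ?_⟩
  rw [← Finset.sum_div, div_self hS.ne']

theorem integral_sum_dirichletMeasure {a : ι → ℝ} (ha : ∀ i, 0 < a i) [Nonempty ι]
    (J : Finset ι) :
    ∫ z, ∑ i ∈ J, z i ∂(dirichletMeasure a) = (∑ i ∈ J, a i) / ∑ i, a i := by
  have hA : ∀ J : Finset ι, 0 ≤ ∑ i ∈ J, a i := fun J => Finset.sum_nonneg fun i _ => (ha i).le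
  have hA1 : 0 < ∑ i, a i := Finset.sum_pos (fun i _ => ha i) Finset.univ_nonempty
  rw [dirichletMeasure, integral_map measurable_normalize.aemeasurable (by fun_prop),
    integral_eq_lintegral_of_nonneg_ae _ (Measurable.aestronglyMeasurable (by fun_prop))]
  · have := lintegral_div_pow_sum_eq ha one_pos (q := fun J x => ∑ i ∈ J, x i)
      (B := fun J => ∑ i ∈ J, a i) (fun J => by fun_prop)
      (fun J x hx => Finset.sum_nonneg fun i _ => (hx i).le) (by simp) hA hA1
      (fun J l hl => integral_sum_tilt ha hl J) J
    simp only [pow_one] at this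
    simp_rw [← Finset.sum_div]
    rw [this, ENNReal.toReal_ofReal (div_nonneg (hA J) hA1.le)]
  · filter_upwards [ae_pos_pi_gamma ha] with x hx
    exact Finset.sum_nonneg fun i _ =>
      div_nonneg (hx i).le (Finset.sum_nonneg fun i _ => (hx i).le)

theorem integral_sum_sq_dirichletMeasure {a : ι → ℝ} (ha : ∀ i, 0 < a i) [Nonempty ι]
    (J : Finset ι) :
    ∫ z, (∑ i ∈ J, z i) ^ 2 ∂(dirichletMeasure a)
      = (∑ i ∈ J, a i) * ((∑ i ∈ J, a i) + 1) / ((∑ i, a i) * ((∑ i, a i) + 1)) := by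
  have hA : ∀ J : Finset ι, 0 ≤ ∑ i ∈ J, a i := fun J => Finset.sum_nonneg fun i _ => (ha i).le
  have hA1 : 0 < ∑ i, a i := Finset.sum_pos (fun i _ => ha i) Finset.univ_nonempty
  have hB : ∀ J : Finset ι, 0 ≤ (∑ i ∈ J, a i) * ((∑ i ∈ J, a i) + 1) := fun J => by
    have := hA J; positivity
  have hB1 : 0 < (∑ i, a i) * ((∑ i, a i) + 1) := by positivity
  rw [dirichletMeasure, integral_map measurable_normalize.aemeasurable (by fun_prop),
    integral_eq_lintegral_of_nonneg_ae (ae_of_all _ fun _ => sq_nonneg _)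
      (Measurable.aestronglyMeasurable (by fun_prop))]
  have := lintegral_div_pow_sum_eq ha two_pos (q := fun J x => (∑ i ∈ J, x i) ^ 2)
    (B := fun J => (∑ i ∈ J, a i) * ((∑ i ∈ J, a i) + 1)) (fun J => by fun_prop)
    (fun J x hx => sq_nonneg _) (by simp) hB hB1
    (fun J l hl => integral_sum_sq_tilt ha hl J) J
  simp_rw [← Finset.sum_div, div_pow]
  rw [this, ENNReal.toReal_ofReal (div_nonneg (hB J) hB1.le)]

end Dirichlet

/-! ### The risk for a fixed vector of knots -/

section Comparison

variable {ι : Type*} [Fintype ι]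

theorem sum_mem_Icc_of_simplex {z : ι → ℝ} (hz : ∀ i, 0 ≤ z i) (hz1 : ∑ i, z i = 1)
    (J : Finset ι) : ∑ i ∈ J, z i ∈ Set.Icc (0 : ℝ) 1 :=
  ⟨Finset.sum_nonneg fun i _ => hz i,
    hz1 ▸ Finset.sum_le_sum_of_subset_of_nonneg J.subset_univ fun i _ _ => hz i⟩

theorem integrable_of_ae_bound_dirichletMeasure {a : ι → ℝ} (ha : ∀ i, 0 < a i) [Nonempty ι]
    {f : (ι → ℝ) → ℝ} (hf : Measurable f) (C : ℝ)
    (h : ∀ z : ι → ℝ, (∀ i, 0 ≤ z i) → ∑ i, z i = 1 → |f z| ≤ C) :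
    Integrable f (dirichletMeasure a) := by
  have := isProbabilityMeasure_dirichletMeasure ha
  refine Integrable.of_bound hf.aestronglyMeasurable C ?_
  filter_upwards [ae_dirichletMeasure ha] with z hz
  exact h z hz.1 hz.2

/-- Squared bias plus variance; the variance is the source of the factor `1 / (1 + θ)` in the limit.
-/
theorem integral_sum_sub_sq_dirichletMeasure {a : ι → ℝ} (ha : ∀ i, 0 < a i) [Nonempty ι]
    (J : Finset ι) (c : ℝ) :
    ∫ z, (∑ i ∈ J, z i - c) ^ 2 ∂(dirichletMeasure a)
      = ((∑ i ∈ J, a i) / ∑ i, a i - c) ^ 2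
        + (∑ i ∈ J, a i) / (∑ i, a i) * (1 - (∑ i ∈ J, a i) / ∑ i, a i) / (1 + ∑ i, a i) := by
  have := isProbabilityMeasure_dirichletMeasure ha
  have hA1 : 0 < ∑ i, a i := Finset.sum_pos (fun i _ => ha i) Finset.univ_nonempty
  have h1 : Integrable (fun z : ι → ℝ => ∑ i ∈ J, z i) (dirichletMeasure a) :=
    integrable_of_ae_bound_dirichletMeasure ha (by fun_prop) 1 fun z hz hz1 => by
      have := sum_mem_Icc_of_simplex hz hz1 J
      rw [abs_le]; constructor <;> linarith [this.1, this.2]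
  have h2 : Integrable (fun z : ι → ℝ => (∑ i ∈ J, z i) ^ 2) (dirichletMeasure a) :=
    integrable_of_ae_bound_dirichletMeasure ha (by fun_prop) 1 fun z hz hz1 => by
      have := sum_mem_Icc_of_simplex hz hz1 J
      rw [abs_le]; constructor <;> nlinarith [this.1, this.2]
  have e : ∀ z : ι → ℝ, (∑ i ∈ J, z i - c) ^ 2
      = (∑ i ∈ J, z i) ^ 2 - (2 * c) * (∑ i ∈ J, z i) + c ^ 2 := fun z => by ring
  simp_rw [e]
  have h3 : Integrable (fun z : ι → ℝ => (∑ i ∈ J, z i) ^ 2 - (2 * c) * ∑ i ∈ J, z i)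
      (dirichletMeasure a) := h2.sub (h1.const_mul _)
  rw [integral_add h3 (integrable_const _), integral_sub h2 (h1.const_mul _), integral_const_mul, integral_sum_dirichletMeasure ha,
    integral_sum_sq_dirichletMeasure ha]
  simp only [integral_const, probReal_univ, one_smul]
  have : 1 + ∑ i, a i ≠ 0 := by positivity
  have : ∑ i, a i + 1 ≠ 0 := by positivity
  field_simp
  ring

/-- If `W` is close to a partial sum of a Dirichlet vector, with mean close to `c`, then its mean
squared deviation from `c` is close to that of the partial sum. -/
theorem abs_integral_sq_sub_le {a : ι → ℝ} (ha : ∀ i, 0 < a i) [Nonempty ι]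
    {W : (ι → ℝ) → ℝ} (hWm : Measurable W) {J J' : Finset ι} {c δ : ℝ}
    (hc : c ∈ Set.Icc (0 : ℝ) 1)
    (hW : ∀ z : ι → ℝ, (∀ i, 0 ≤ z i) → ∑ i, z i = 1 → |W z - ∑ i ∈ J, z i| ≤ ∑ i ∈ J', z i)
    (hJ : |(∑ i ∈ J, a i) / ∑ i, a i - c| ≤ δ) (hJ' : (∑ i ∈ J', a i) / ∑ i, a i ≤ δ) :
    |∫ z, (W z - c) * (W z - c) ∂(dirichletMeasure a) - 1 / (1 + ∑ i, a i) * (c * (1 - c))|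
      ≤ 5 * δ := by
  have := isProbabilityMeasure_dirichletMeasure ha
  have hA1 : 0 < ∑ i, a i := Finset.sum_pos (fun i _ => ha i) Finset.univ_nonempty
  -- Replacing `W` by the partial sum costs `3 δ`: a difference of squares, with one factor at most
  -- `1 + 2`.
  have key : ∀ z : ι → ℝ, (∀ i, 0 ≤ z i) → ∑ i, z i = 1 →
      |(W z - c) * (W z - c) - (∑ i ∈ J, z i - c) ^ 2| ≤ 3 * ∑ i ∈ J', z i := by
    intro z hz hz1
    have e1 := sum_mem_Icc_of_simplex hz hz1 J
    have e2 := sum_mem_Icc_of_simplex hz hz1 J'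
    have e3 := hW z hz hz1
    have : (W z - c) * (W z - c) - (∑ i ∈ J, z i - c) ^ 2
      = (W z - ∑ i ∈ J, z i + 2 * (∑ i ∈ J, z i - c)) * (W z - ∑ i ∈ J, z i) := by ring
    rw [this, abs_mul]
    refine mul_le_mul ?_ e3 (abs_nonneg _) (by norm_num)
    rw [abs_le] at e3 ⊢
    constructor <;> linarith [e1.1, e1.2, e2.1, e2.2, e3.1, e3.2, hc.1, hc.2]
  have i1 : Integrable (fun z => (W z - c) * (W z - c)) (dirichletMeasure a) :=
    integrable_of_ae_bound_dirichletMeasure ha (by fun_prop) 4 fun z hz hz1 => by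
      have e1 := sum_mem_Icc_of_simplex hz hz1 J
      have e2 := sum_mem_Icc_of_simplex hz hz1 J'
      have e3 := abs_le.mp (key z hz hz1)
      rw [abs_le]; constructor <;> nlinarith [e1.1, e1.2, e2.1, e2.2, hc.1, hc.2]
  have i2 : Integrable (fun z : ι → ℝ => (∑ i ∈ J, z i - c) ^ 2) (dirichletMeasure a) :=
    integrable_of_ae_bound_dirichletMeasure ha (by fun_prop) 1 fun z hz hz1 => by
      have e1 := sum_mem_Icc_of_simplex hz hz1 J
      rw [abs_le]; constructor <;> nlinarith [e1.1, e1.2, hc.1, hc.2]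
  have i3 : Integrable (fun z : ι → ℝ => 3 * ∑ i ∈ J', z i) (dirichletMeasure a) :=
    integrable_of_ae_bound_dirichletMeasure ha (by fun_prop) 3 fun z hz hz1 => by
      have e1 := sum_mem_Icc_of_simplex hz hz1 J'
      rw [abs_le]; constructor <;> nlinarith [e1.1, e1.2]
  have b1 : |∫ z, (W z - c) * (W z - c) ∂(dirichletMeasure a)
      - ∫ z, (∑ i ∈ J, z i - c) ^ 2 ∂(dirichletMeasure a)| ≤ 3 * δ := by
    rw [← integral_sub i1 i2]
    calc _ ≤ ∫ z, 3 * ∑ i ∈ J', z i ∂(dirichletMeasure a) := by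
          rw [← Real.norm_eq_abs]
          refine norm_integral_le_of_norm_le i3 ?_
          filter_upwards [ae_dirichletMeasure ha] with z hz
          exact key z hz.1 hz.2
      _ ≤ _ := by
          rw [integral_const_mul, integral_sum_dirichletMeasure ha]; linarith
  rw [integral_sum_sub_sq_dirichletMeasure ha] at b1
  have hm := sum_mem_Icc_of_simplex (z := fun i => a i / ∑ i, a i)
    (fun i => div_nonneg (ha i).le hA1.le) (by rw [← Finset.sum_div, div_self hA1.ne']) J
  rw [← Finset.sum_div] at hm
  set m := (∑ i ∈ J, a i) / ∑ i, a i
  set r := 1 / (1 + ∑ i, a i) with hr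
  have hr0 : 0 ≤ r := by positivity
  have hr1 : r ≤ 1 := by rw [hr, div_le_one (by positivity)]; linarith
  have e : m * (1 - m) / (1 + ∑ i, a i) = r * (m * (1 - m)) := by rw [hr]; ring
  rw [e] at b1
  -- Replacing the mean `m` by `c` costs the remaining `2 δ`.
  have b2 : |(m - c) ^ 2 + r * (m * (1 - m)) - r * (c * (1 - c))| ≤ 2 * |m - c| := by
    have : (m - c) ^ 2 + r * (m * (1 - m)) - r * (c * (1 - c))
      = ((m - c) + r * (1 - m - c)) * (m - c) := by ring
    rw [this, abs_mul]
    refine mul_le_mul_of_nonneg_right ?_ (abs_nonneg _)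
    refine (abs_add_le _ _).trans ?_
    rw [abs_mul, abs_of_nonneg hr0]
    have h1 : |m - c| ≤ 1 := by
      rw [abs_le]; constructor <;> linarith [hm.1, hm.2, hc.1, hc.2]
    have h2 : |1 - m - c| ≤ 1 := by
      rw [abs_le]; constructor <;> linarith [hm.1, hm.2, hc.1, hc.2]
    nlinarith [abs_nonneg (1 - m - c)]
  rw [abs_le] at b1 b2 ⊢
  constructor <;> linarith [b1.1, b1.2, b2.1, b2.2, hJ]

/-- The `L²` risk of a random path every value of which is close to a partial sum of a Dirichlet
vector. -/
theorem abs_integral_l2NormSq_sub_le {a : ι → ℝ} (ha : ∀ i, 0 < a i) [Nonempty ι]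
    {W : (ι → ℝ) → ℝ → ℝ} (hWm : Measurable (Function.uncurry W)) {Φ : ℝ → ℝ}
    (hΦ : Continuous Φ) (hΦ1 : ∀ t, Φ t ∈ Set.Icc (0 : ℝ) 1) {δ : ℝ}
    (h : ∀ t ∈ Set.Ico (0 : ℝ) 1, ∃ J J' : Finset ι,
      (∀ z : ι → ℝ, (∀ i, 0 ≤ z i) → ∑ i, z i = 1 → |W z t - ∑ i ∈ J, z i| ≤ ∑ i ∈ J', z i) ∧
      |(∑ i ∈ J, a i) / ∑ i, a i - Φ t| ≤ δ ∧ (∑ i ∈ J', a i) / ∑ i, a i ≤ δ) :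
    |∫ z, l2NormSq (fun t => W z t - Φ t) ∂(dirichletMeasure a)
      - 1 / (1 + ∑ i, a i) * ∫ t in (0 : ℝ)..1, Φ t * (1 - Φ t)| ≤ 5 * δ := by
  have := isProbabilityMeasure_dirichletMeasure ha
  have hmeas : Measurable (Function.uncurry fun z t => (W z t - Φ t) * (W z t - Φ t)) := by
    have h2 : Measurable fun p : (ι → ℝ) × ℝ => Φ p.2 := hΦ.measurable.comp measurable_snd
    exact (hWm.sub h2).mul (hWm.sub h2)
  have hvol : IsProbabilityMeasure (volume.restrict (Set.Ioo (0 : ℝ) 1)) := ⟨by simp⟩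
  have hint : Integrable (Function.uncurry fun z t => (W z t - Φ t) * (W z t - Φ t))
      ((dirichletMeasure a).prod (volume.restrict (Set.Ioo (0 : ℝ) 1))) := by
    refine Integrable.of_bound hmeas.aestronglyMeasurable 9 ?_
    have q1 := Measure.quasiMeasurePreserving_fst.ae (μa := (dirichletMeasure a).prod
      (volume.restrict (Set.Ioo (0 : ℝ) 1)))
      (ae_dirichletMeasure ha)
    have q2 := Measure.quasiMeasurePreserving_snd.ae (μa := (dirichletMeasure a).prod
      (volume.restrict (Set.Ioo (0 : ℝ) 1)))
      (ae_restrict_mem (μ := volume) (measurableSet_Ioo (a := (0 : ℝ)) (b := 1)))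
    filter_upwards [q1, q2] with p h1 h2
    obtain ⟨J, J', hJ, -, -⟩ := h p.2 ⟨h2.1.le, h2.2⟩
    have e1 := sum_mem_Icc_of_simplex h1.1 h1.2 J
    have e2 := sum_mem_Icc_of_simplex h1.1 h1.2 J'
    have e3 := abs_le.mp (hJ _ h1.1 h1.2)
    have e4 := hΦ1 p.2
    simp only [Function.uncurry, Real.norm_eq_abs]
    have e5 : |W p.1 p.2 - Φ p.2| ≤ 3 := by
      rw [abs_le]; constructor <;> linarith [e1.1, e1.2, e2.1, e2.2, e3.1, e3.2, e4.1, e4.2]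
    rw [abs_mul]
    nlinarith [abs_nonneg (W p.1 p.2 - Φ p.2)]
  -- Passing to the open interval discards the endpoint `1`, about which `h` says nothing.
  simp only [l2NormSq, intervalIntegral.integral_of_le zero_le_one, integral_Ioc_eq_integral_Ioo]
  rw [integral_integral_swap hint, ← integral_const_mul, ← integral_sub]
  · have := norm_setIntegral_le_of_norm_le_const (μ := volume) (s := Set.Ioo (0 : ℝ) 1)
      (C := 5 * δ) (f := fun t => ∫ z, (W z t - Φ t) * (W z t - Φ t) ∂(dirichletMeasure a)
        - 1 / (1 + ∑ i, a i) * (Φ t * (1 - Φ t))) (by simp) (fun t ht => by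
      obtain ⟨J, J', hJ, hJ1, hJ2⟩ := h t ⟨ht.1.le, ht.2⟩
      exact abs_integral_sq_sub_le ha (hWm.comp (measurable_id.prodMk measurable_const))
        (hΦ1 t) hJ hJ1 hJ2)
    simpa using this
  · exact hint.integral_prod_right
  · refine Integrable.const_mul ?_ _
    exact (Continuous.integrableOn_Icc (a := 0) (b := 1) (by fun_prop)).mono_set
      Set.Ioo_subset_Icc_self

end Comparison

/-! ### Piecewise linear interpolation: localisation, bounds and joint measurability. -/

section Interpolation

variable {n : ℕ}

/-- If `t` lay in no cell, `y k ≤ t` would propagate by induction up to the last knot. -/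
theorem exists_mem_Ico_knots {y : Fin (n + 2) → ℝ} (h0 : y 0 = 0) (h1 : y (Fin.last _) = 1)
    {t : ℝ} (ht : t ∈ Set.Ico (0 : ℝ) 1) :
    ∃ j : Fin (n + 1), t ∈ Set.Ico (y j.castSucc) (y j.succ) := by
  by_contra! hcon
  have : ∀ k, y k ≤ t := fun k => by
    induction k using Fin.induction with
    | zero => rw [h0]; exact ht.1
    | succ j ih => by_contra! hj; exact hcon j ⟨ih, hj⟩
  linarith [this (Fin.last _), ht.2]

theorem interpPath_eq {y : Fin (n + 2) → ℝ} (hy : Monotone y) (a : Fin (n + 2) → ℝ) {t : ℝ}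
    (ht : t ≠ 1) {j : Fin (n + 1)} (hj : t ∈ Set.Ico (y j.castSucc) (y j.succ)) :
    interpPath y a t = cumSum a j.castSucc
      + a j.succ * ((t - y j.castSucc) / (y j.succ - y j.castSucc)) := by
  rw [interpPath, if_neg ht, Finset.sum_eq_single j, Set.indicator_of_mem hj]
  · intro k _ hk
    refine Set.indicator_of_notMem (fun hmem => ?_) _
    rcases lt_or_gt_of_ne hk with hlt | hlt
    · have : y k.succ ≤ y j.castSucc := hy (by rw [Fin.le_def]; simpa using hlt)
      linarith [hmem.2, hj.1]
    · have : y j.succ ≤ y k.castSucc := hy (by rw [Fin.le_def]; simpa using hlt)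
      linarith [hmem.1, hj.2]
  · simp

theorem interpWeight_mem_Icc {u v t : ℝ} (ht : t ∈ Set.Ico u v) :
    (t - u) / (v - u) ∈ Set.Icc (0 : ℝ) 1 := by
  have : 0 < v - u := by linarith [ht.1, ht.2]
  exact ⟨div_nonneg (by linarith [ht.1]) this.le, by rw [div_le_one this]; linarith [ht.2]⟩

theorem cumSum_succ (a : Fin (n + 2) → ℝ) (j : Fin (n + 1)) :
    cumSum a j.succ = cumSum a j.castSucc + a j.succ := by
  have : Finset.Iic j.succ = insert j.succ (Finset.Iic j.castSucc) := by
    ext k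
    simp only [Finset.mem_Iic, Finset.mem_insert, Fin.le_def, Fin.ext_iff, Fin.val_succ,
      Fin.val_castSucc]
    omega
  rw [cumSum, cumSum, this, Finset.sum_insert (by simp [Fin.le_def]), add_comm]

theorem interpPath_mem_Icc {y : Fin (n + 2) → ℝ} (hy : Monotone y) (h0 : y 0 = 0)
    (h1 : y (Fin.last _) = 1) {a : Fin (n + 2) → ℝ} (ha : ∀ i, 0 ≤ a i) (ha1 : ∑ i, a i = 1)
    {t : ℝ} (ht : t ∈ Set.Icc (0 : ℝ) 1) : interpPath y a t ∈ Set.Icc (0 : ℝ) 1 := by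
  by_cases htt : t = 1
  · simp [interpPath, htt]
  · obtain ⟨j, hj⟩ := exists_mem_Ico_knots h0 h1 ⟨ht.1, lt_of_le_of_ne ht.2 htt⟩
    rw [interpPath_eq hy a htt hj]
    have w := interpWeight_mem_Icc hj
    have c1 := sum_mem_Icc_of_simplex ha ha1 (Finset.Iic j.castSucc)
    have c2 := sum_mem_Icc_of_simplex ha ha1 (Finset.Iic j.succ)
    have c3 := cumSum_succ a j
    simp only [cumSum] at c3 ⊢
    have := ha j.succ
    constructor
    · nlinarith [w.1, w.2, c1.1]
    · nlinarith [w.1, w.2, c2.2]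

/-- Joint measurability in knots, jumps and time makes the squared norm a random variable and allows
Fubini. -/
theorem measurable_interpPath :
    Measurable fun p : (Fin (n + 2) → ℝ) × (Fin (n + 2) → ℝ) × ℝ =>
      interpPath p.1 p.2.1 p.2.2 := by
  unfold interpPath
  refine Measurable.ite (measurableSet_eq_fun (by fun_prop) (by fun_prop)) (by fun_prop) ?_
  refine Finset.measurable_sum _ fun j _ => ?_
  have e : (fun p : (Fin (n + 2) → ℝ) × (Fin (n + 2) → ℝ) × ℝ =>
      (Set.Ico (p.1 j.castSucc) (p.1 j.succ)).indicator (fun s => cumSum p.2.1 j.castSucc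
        + p.2.1 j.succ * ((s - p.1 j.castSucc) / (p.1 j.succ - p.1 j.castSucc))) p.2.2)
      = Set.indicator {p | p.1 j.castSucc ≤ p.2.2 ∧ p.2.2 < p.1 j.succ}
        fun p => cumSum p.2.1 j.castSucc
        + p.2.1 j.succ * ((p.2.2 - p.1 j.castSucc) / (p.1 j.succ - p.1 j.castSucc)) := by
    ext p
    simp [Set.indicator]
  rw [e]
  refine Measurable.indicator (by unfold cumSum; fun_prop) ?_
  have h1 : MeasurableSet {p : (Fin (n + 2) → ℝ) × (Fin (n + 2) → ℝ) × ℝ |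
      p.1 j.castSucc ≤ p.2.2} := measurableSet_le (by fun_prop) (by fun_prop)
  have h2 : MeasurableSet {p : (Fin (n + 2) → ℝ) × (Fin (n + 2) → ℝ) × ℝ |
      p.2.2 < p.1 j.succ} := measurableSet_lt (by fun_prop) (by fun_prop)
  exact h1.inter h2

theorem l2NormSq_mem_Icc {f : ℝ → ℝ} (hf : ∀ t ∈ Set.Icc (0 : ℝ) 1, |f t| ≤ 1) :
    l2NormSq f ∈ Set.Icc (0 : ℝ) 1 := by
  refine ⟨intervalIntegral.integral_nonneg zero_le_one fun t _ => mul_self_nonneg _, ?_⟩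
  have := intervalIntegral.norm_integral_le_of_norm_le_const (a := 0) (b := 1) (C := 1)
    (f := fun t => f t * f t) (fun t ht => by
      rw [Set.uIoc_of_le zero_le_one] at ht
      have := hf t ⟨ht.1.le, ht.2⟩
      rw [Real.norm_eq_abs, abs_mul]
      nlinarith [abs_nonneg (f t)])
  simp only [sub_zero, abs_one, mul_one] at this
  exact (le_abs_self _).trans this

theorem l2NormSq_congr {f g : ℝ → ℝ} (h : ∀ t ∈ Set.Icc (0 : ℝ) 1, f t = g t) :
    l2NormSq f = l2NormSq g := by
  refine intervalIntegral.integral_congr fun t ht => ?_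
  rw [Set.uIcc_of_le zero_le_one] at ht
  simp only [h t ht]

theorem measurable_l2NormSq_interpPath {S E : Type*} [MeasurableSpace S] [MeasurableSpace E]
    {K : S → Fin (n + 2) → ℝ} (hK : Measurable K) {A : E → Fin (n + 2) → ℝ} (hA : Measurable A)
    {Φ : ℝ → ℝ} (hΦ : Measurable Φ) :
    Measurable fun p : S × E => l2NormSq fun t => interpPath (K p.1) (A p.2) t - Φ t := by
  simp only [l2NormSq, intervalIntegral.integral_of_le zero_le_one]
  have h1 : Measurable fun q : (S × E) × ℝ => interpPath (K q.1.1) (A q.1.2) q.2 - Φ q.2 :=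
    (measurable_interpPath.comp ((hK.comp measurable_fst.fst).prodMk
      ((hA.comp measurable_fst.snd).prodMk measurable_snd))).sub (hΦ.comp measurable_snd)
  exact ((h1.mul h1).stronglyMeasurable.integral_prod_right'
    (ν := volume.restrict (Set.Ioc (0 : ℝ) 1))).measurable

end Interpolation

/-! ### The sorted sample -/

section SortedKnots

variable {n : ℕ}

@[simp] theorem sortedKnots_zero (u : Fin n → ℝ) : sortedKnots u 0 = 0 := rfl

@[simp] theorem sortedKnots_last (u : Fin n → ℝ) : sortedKnots u (Fin.last _) = 1 := by
  rw [sortedKnots, ← Fin.succ_last, Fin.cons_succ, Fin.snoc_last]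

@[simp] theorem sortedKnots_castSucc_succ (u : Fin n → ℝ) (i : Fin n) :
    sortedKnots u i.castSucc.succ = u (Tuple.sort u i) := by
  rw [sortedKnots, Fin.cons_succ, Fin.snoc_castSucc]; rfl

theorem forall_fin_add_two {p : Fin (n + 2) → Prop} (h0 : p 0) (h1 : p (Fin.last _))
    (h : ∀ i : Fin n, p i.castSucc.succ) (j : Fin (n + 2)) : p j := by
  cases j using Fin.cases with
  | zero => exact h0
  | succ j =>
    cases j using Fin.lastCases with
    | last => exact h1
    | cast i => exact h i

/-- The dictionary between order statistics, indexed from `0`, and empirical counts. Measurability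
of the sorted sample and its closeness to the grid both rest on it. -/
theorem sort_le_iff (u : Fin n → ℝ) (i : Fin n) (s : ℝ) :
    u (Tuple.sort u i) ≤ s ↔ (i : ℕ) < (Finset.univ.filter fun k => u k ≤ s).card := by
  have h := Tuple.lt_card_le_iff_apply_le_of_monotone (j := i) (a := s) (Tuple.monotone_sort u)
  rw [← Function.comp_apply (f := u), ← h]
  have : (Finset.univ.filter fun k => (u ∘ Tuple.sort u) k ≤ s).card
      = (Finset.univ.filter fun k => u k ≤ s).card :=
    Finset.card_equiv (Tuple.sort u) (by simp)
  rw [this]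

theorem card_filter_le_eq_sum (u : Fin n → ℝ) (s : ℝ) :
    ((Finset.univ.filter fun k => u k ≤ s).card : ℝ)
      = ∑ k, (Set.Iic s).indicator (fun _ => (1 : ℝ)) (u k) := by
  simp [Set.indicator_apply, Finset.sum_boole]

theorem measurable_sortedKnots : Measurable (sortedKnots : (Fin n → ℝ) → Fin (n + 2) → ℝ) := by
  rw [measurable_pi_iff]
  refine forall_fin_add_two (by simp) (by simp) fun i => ?_
  simp only [sortedKnots_castSucc_succ]
  refine measurable_of_Iic fun s => ?_
  have e : (fun u : Fin n → ℝ => u (Tuple.sort u i)) ⁻¹' Set.Iic s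
      = {u | ((i : ℕ) : ℝ) < ∑ k, (Set.Iic s).indicator (fun _ => (1 : ℝ)) (u k)} := by
    ext u
    rw [Set.mem_preimage, Set.mem_Iic, sort_le_iff, Set.mem_ofPred_eq, ← card_filter_le_eq_sum,
      Nat.cast_lt]
  rw [e]
  refine measurableSet_lt measurable_const (Finset.measurable_sum _ fun k _ => ?_)
  exact (measurable_const.indicator measurableSet_Iic).comp (measurable_pi_apply k)

theorem strictMono_sortedKnots {u : Fin n → ℝ} (hu : ∀ i, u i ∈ Set.Ioo (0 : ℝ) 1)
    (hinj : Function.Injective u) : StrictMono (sortedKnots u) := by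
  have hinj' : Function.Injective (u ∘ Tuple.sort u) := hinj.comp (Tuple.sort u).injective
  rw [Fin.strictMono_iff_lt_succ]
  intro j
  cases j using Fin.cases with
  | zero =>
    cases n with
    | zero =>
      exact (sortedKnots_zero u).le.trans_lt (zero_lt_one.trans_le (sortedKnots_last u).ge)
    | succ n =>
      have := sortedKnots_castSucc_succ u 0
      exact (sortedKnots_zero u).le.trans_lt ((hu _).1.trans_le this.ge)
  | succ j =>
    rw [← Fin.succ_castSucc, sortedKnots_castSucc_succ]
    by_cases hj : (j : ℕ) + 1 = n
    · have : j.succ.succ = Fin.last _ := by ext; simp [hj]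
      rw [this, sortedKnots_last]; exact (hu _).2
    · have : j.succ.succ = (⟨j + 1, by omega⟩ : Fin n).castSucc.succ := by ext; simp
      rw [this, sortedKnots_castSucc_succ]
      exact (Tuple.monotone_sort u).strictMono_of_injective hinj' (by rw [Fin.lt_def]; simp)

/-- If the empirical distribution function is close to that of the uniform law on a fine grid, then
the sorted sample is close to the uniform grid. -/
theorem abs_sort_sub_le {u : Fin n → ℝ} (hu : ∀ i, u i ∈ Set.Icc (0 : ℝ) 1) {ε : ℝ}
    {K : ℕ} (hK : 2 < ε * K)
    (h : ∀ k ≤ K, |((Finset.univ.filter fun i => u i ≤ (k / K : ℝ)).card : ℝ) - n * (k / K)|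
      < n * (ε / 2)) (i : Fin n) :
    |u (Tuple.sort u i) - ((i : ℕ) + 1) / n| ≤ ε := by
  have hn : (0 : ℝ) < n := by exact_mod_cast i.pos
  have hK0 : (0 : ℝ) < K := by
    rcases K.eq_zero_or_pos with rfl | hk
    · norm_num at hK
    · exact_mod_cast hk
  have hε : 0 < ε := by by_contra hc; nlinarith
  have hx := hu (Tuple.sort u i)
  set q : ℝ := ((i : ℕ) + 1) / n with hq
  have hqn : q * n = (i : ℕ) + 1 := by rw [hq]; field_simp
  have hq0 : 0 < q := by positivity
  rw [abs_le]
  constructor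
  · by_contra! hc
    have hz : 0 < q - ε := by linarith [hx.1]
    -- Since `1 / K < ε / 2`, some grid point `k / K` lies in `[q - ε, q - ε / 2)`. At least `i + 1
    -- = q n` sample points lie below it, an excess of more than `n ε / 2`.
    have c1 := Nat.le_ceil ((q - ε) * K)
    have c2 := Nat.ceil_lt_add_one (mul_nonneg hz.le hK0.le)
    set k := ⌈(q - ε) * K⌉₊
    have hq1 : q ≤ 1 := by
      rw [hq, div_le_one hn]; exact_mod_cast i.2
    have hk : k ≤ K := by
      have : (k : ℝ) < K + 1 := by nlinarith
      exact Nat.lt_succ_iff.mp (by exact_mod_cast this)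
    have hs1 : q - ε ≤ k / K := by rw [le_div_iff₀ hK0]; exact c1
    have hs2 : (k / K : ℝ) < q - ε / 2 := by rw [div_lt_iff₀ hK0]; nlinarith
    have h1 := (sort_le_iff u i (k / K)).mp (by linarith)
    have h2 := (abs_lt.mp (h k hk)).2
    have h3 : ((i : ℕ) : ℝ) + 1
      ≤ ((Finset.univ.filter fun i => u i ≤ (k / K : ℝ)).card : ℝ) := by exact_mod_cast h1
    nlinarith
  · by_contra! hc
    have hz : q + ε < 1 := by linarith [hx.2]
    -- Symmetrically, with a grid point in `[q + ε / 2, q + ε)` that has at most `i < q n` sample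
    -- points below it.
    have c1 := Nat.le_ceil ((q + ε / 2) * K)
    have c2 := Nat.ceil_lt_add_one (mul_nonneg (by positivity : 0 ≤ q + ε / 2) hK0.le)
    set k := ⌈(q + ε / 2) * K⌉₊
    have hk : k ≤ K := by
      have : (k : ℝ) < K + 1 := by nlinarith
      exact Nat.lt_succ_iff.mp (by exact_mod_cast this)
    have hs1 : q + ε / 2 ≤ k / K := by rw [le_div_iff₀ hK0]; exact c1
    have hs2 : (k / K : ℝ) < q + ε := by rw [div_lt_iff₀ hK0]; nlinarith
    have h1 := (not_congr (sort_le_iff u i (k / K))).mp (by linarith)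
    have h2 := (abs_lt.mp (h k hk)).1
    have h3 : ((Finset.univ.filter fun i => u i ≤ (k / K : ℝ)).card : ℝ) ≤ (i : ℕ) := by
      exact_mod_cast not_lt.mp h1
    nlinarith

end SortedKnots

/-! ### Uniform samples: distinctness and concentration around the grid. -/

section UniformSample

theorem aemeasurable_sortedKnots {Ω : Type*} [MeasurableSpace Ω] {P : Measure Ω} {n : ℕ}
    {U : Fin n → Ω → ℝ}
    (hU : ∀ i, HasLaw (U i) (volume.restrict (Set.Icc (0 : ℝ) 1)) P) :
    AEMeasurable (fun ω => sortedKnots fun i => U i ω) P :=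
  measurable_sortedKnots.comp_aemeasurable (aemeasurable_pi_lambda _ fun i => (hU i).aemeasurable)

variable {Ω : Type*} [MeasurableSpace Ω] {P : Measure Ω} {n : ℕ}
  {U : Fin n → Ω → ℝ}

theorem ae_uniform_mem_Ioo
    (hU : ∀ i, HasLaw (U i) (volume.restrict (Set.Icc (0 : ℝ) 1)) P) :
    ∀ᵐ ω ∂P, ∀ i, U i ω ∈ Set.Ioo (0 : ℝ) 1 := by
  rw [ae_all_iff]
  intro i
  refine ae_of_ae_map (p := fun x => x ∈ Set.Ioo (0 : ℝ) 1) (hU i).aemeasurable ?_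
  rw [(hU i).map_eq, ← Measure.restrict_congr_set Ioo_ae_eq_Icc]
  exact ae_restrict_mem measurableSet_Ioo

variable [IsProbabilityMeasure P]

theorem ae_uniform_injective (hind : iIndepFun U P)
    (hU : ∀ i, HasLaw (U i) (volume.restrict (Set.Icc (0 : ℝ) 1)) P) :
    ∀ᵐ ω ∂P, Function.Injective fun i => U i ω := by
  have h : ∀ i j, i ≠ j → ∀ᵐ ω ∂P, U i ω ≠ U j ω := by
    intro i j hij
    have hlaw := (indepFun_iff_map_prod_eq_prod_map_map (hU i).aemeasurable
      (hU j).aemeasurable).mp (hind.indepFun hij)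
    rw [(hU i).map_eq, (hU j).map_eq] at hlaw
    refine ae_of_ae_map (p := fun x : ℝ × ℝ => x.1 ≠ x.2)
      ((hU i).aemeasurable.prodMk (hU j).aemeasurable) ?_
    have hm : MeasurableSet {z : ℝ × ℝ | z.1 ≠ z.2} :=
      (measurableSet_eq_fun measurable_fst measurable_snd).compl
    rw [hlaw]
    refine (Measure.ae_prod_iff_ae_ae hm).mpr (ae_of_all _ fun x => ?_)
    rw [ae_iff]
    simp
  have h' : ∀ᵐ ω ∂P, ∀ i j, i ≠ j → U i ω ≠ U j ω := by
    rw [ae_all_iff]; intro i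
    rw [ae_all_iff]; intro j
    by_cases hij : i = j
    · simp [hij]
    · simpa [hij] using h i j hij
  filter_upwards [h'] with ω hω i j hij
  by_contra hne
  exact hω i j hne hij

theorem measure_le_abs_card_sub_le (hind : iIndepFun U P)
    (hU : ∀ i, HasLaw (U i) (volume.restrict (Set.Icc (0 : ℝ) 1)) P) {s : ℝ}
    (hs : s ∈ Set.Icc (0 : ℝ) 1) {c : ℝ} (hc : 0 < c) :
    P {ω | c ≤ |((Finset.univ.filter fun i => U i ω ≤ s).card : ℝ) - n * s|}
      ≤ ENNReal.ofReal (n / c ^ 2) := by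
  set X : Fin n → Ω → ℝ := fun i ω => (Set.Iic s).indicator (fun _ => (1 : ℝ)) (U i ω) with hX
  have hφm : Measurable ((Set.Iic s).indicator fun _ => (1 : ℝ)) :=
    measurable_const.indicator measurableSet_Iic
  have hXm : ∀ i, AEMeasurable (X i) P := fun i => hφm.comp_aemeasurable (hU i).aemeasurable
  have hX01 : ∀ i ω, X i ω ∈ Set.Icc (0 : ℝ) 1 := fun i ω => by
    simp only [hX, Set.indicator_apply]; split_ifs <;> simp
  have hX2 : ∀ i, MemLp (X i) 2 P := fun i =>
    memLp_of_bounded (ae_of_all _ (hX01 i)) (hXm i).aestronglyMeasurable 2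
  have hmean : ∀ i, ∫ ω, X i ω ∂P = s := fun i => by
    have := integral_map (hU i).aemeasurable
      (f := (Set.Iic s).indicator fun _ => (1 : ℝ)) hφm.aestronglyMeasurable
    rw [(hU i).map_eq] at this
    rw [hX]
    simp only
    rw [← this, integral_indicator measurableSet_Iic, Measure.restrict_restrict measurableSet_Iic]
    have e : Set.Iic s ∩ Set.Icc 0 1 = Set.Icc 0 s := by
      ext x; simp only [Set.mem_inter_iff, Set.mem_Iic, Set.mem_Icc]
      constructor
      · rintro ⟨h1, h2, h3⟩; exact ⟨h2, h1⟩
      · rintro ⟨h1, h2⟩; exact ⟨h2, h1, h2.trans hs.2⟩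
    rw [e]
    simp [hs.1]
  -- Each indicator has variance at most `1 / 4`; the cruder bound `1` suffices.
  have hvar : variance (∑ i, X i) P ≤ n := by
    rw [IndepFun.variance_sum (fun i _ => hX2 i) fun i _ j _ hij =>
      (hind.indepFun hij).comp hφm hφm]
    calc _ ≤ ∑ i : Fin n, (1 : ℝ) := Finset.sum_le_sum fun i _ => by
          refine (variance_le_sq_of_bounded (ae_of_all _ (hX01 i)) (hXm i)).trans (by norm_num)
      _ = n := by simp
  have hcheb := meas_ge_le_variance_div_sq (memLp_finsetSum' Finset.univ fun i _ => hX2 i) hc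
  have e : ∫ ω, (∑ i, X i) ω ∂P = n * s := by
    simp only [Finset.sum_apply]
    rw [integral_finsetSum _ fun i _ => (hX2 i).integrable one_le_two]
    simp [hmean]
  rw [e] at hcheb
  have e2 : ∀ ω, (∑ i, X i) ω = ((Finset.univ.filter fun i => U i ω ≤ s).card : ℝ) := fun ω => by
    rw [card_filter_le_eq_sum, Finset.sum_apply]
  simp only [e2] at hcheb
  refine hcheb.trans (ENNReal.ofReal_le_ofReal ?_)
  gcongr

/-- Union bound over the `K + 1` points `k / K`, off which `abs_sort_sub_le` applies. As `K` depends
on `ε` alone, the bound is `O(1 / n)`. -/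
theorem measure_not_close_le (hind : iIndepFun U P)
    (hU : ∀ i, HasLaw (U i) (volume.restrict (Set.Icc (0 : ℝ) 1)) P) {ε : ℝ}
    {K : ℕ} (hK : 2 < ε * K) (hn : 1 ≤ ε * n) :
    P {ω | ¬ ∀ j, |sortedKnots (fun i => U i ω) j - (j : ℕ) / n| ≤ ε}
      ≤ ENNReal.ofReal ((K + 1) * (n / (n * (ε / 2)) ^ 2)) := by
  have hε : 0 < ε := by
    by_contra hc
    have : (0 : ℝ) ≤ K := K.cast_nonneg
    nlinarith
  have hn0 : (0 : ℝ) < n := by by_contra hc; nlinarith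
  have hK0 : (0 : ℝ) < K := by by_contra hc; nlinarith
  have hc : 0 < n * (ε / 2) := by positivity
  have hsub : ∀ᵐ ω ∂P, ω ∈ {ω | ¬ ∀ j, |sortedKnots (fun i => U i ω) j - (j : ℕ) / n| ≤ ε} →
      ω ∈ ⋃ k ∈ Finset.range (K + 1), {ω | n * (ε / 2) ≤
        |((Finset.univ.filter fun i => U i ω ≤ (k / K : ℝ)).card : ℝ) - n * (k / K)|} := by
    filter_upwards [ae_uniform_mem_Ioo hU] with ω hω hbad
    by_contra hgood
    refine hbad (forall_fin_add_two ?_ ?_ fun i => ?_)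
    · simp [hε.le]
    -- The last knot is `1` but its grid point is `(n + 1) / n`; `hn` absorbs the difference.
    · have : (1 : ℝ) - (((n + 1 : ℕ) : ℝ)) / n = - (1 / n) := by push_cast; field_simp; ring
      rw [sortedKnots_last, Fin.val_last, this, abs_neg, abs_of_pos (by positivity),
        div_le_iff₀ hn0]
      exact hn
    · have := abs_sort_sub_le (fun i => Set.Ioo_subset_Icc_self (hω i)) hK (fun k hk => by
        by_contra! hcon
        exact hgood (Set.mem_biUnion (by simpa [Nat.lt_succ_iff] using hk) hcon)) i
      simpa using this
  refine (measure_mono_ae hsub).trans ((measure_biUnion_finset_le _ _).trans ?_)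
  calc _ ≤ ∑ k ∈ Finset.range (K + 1), ENNReal.ofReal (n / (n * (ε / 2)) ^ 2) := by
        refine Finset.sum_le_sum fun k hk => measure_le_abs_card_sub_le hind hU ⟨?_, ?_⟩ hc
        · positivity
        · rw [div_le_one hK0]
          exact_mod_cast Nat.lt_succ_iff.mp (Finset.mem_range.mp hk)
    _ = _ := by
        rw [Finset.sum_const, Finset.card_range, nsmul_eq_mul, ENNReal.ofReal_mul (by positivity)]
        congr 1
        rw [ENNReal.ofReal_add hK0.le zero_le_one]
        simp

end UniformSample

/-! ### The risk for random knots -/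

section Disintegration

/-- Condition on the first coordinate: on `G` the error is at most `r`, and off `G` it is at most
`1`, since the conditional mean and `L` both lie in `[0, 1]`. -/
theorem abs_integral_compProd_sub_le {S E : Type*} [MeasurableSpace S] [MeasurableSpace E]
    {ν : Measure S} [IsProbabilityMeasure ν] {κ : Kernel S E} [IsMarkovKernel κ] {F : S × E → ℝ}
    (hF : Measurable F) (hF1 : ∀ᵐ p ∂(ν ⊗ₘ κ), F p ∈ Set.Icc (0 : ℝ) 1) {G : Set S}
    (hG : MeasurableSet G) {L r : ℝ} (hr : 0 ≤ r) (hL : L ∈ Set.Icc (0 : ℝ) 1)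
    (h : ∀ᵐ x ∂ν, x ∈ G → |∫ y, F (x, y) ∂(κ x) - L| ≤ r) :
    |∫ p, F p ∂(ν ⊗ₘ κ) - L| ≤ r + ν.real Gᶜ := by
  have hint : Integrable F (ν ⊗ₘ κ) := by
    refine Integrable.of_bound hF.aestronglyMeasurable 1 ?_
    filter_upwards [hF1] with p hp
    rw [Real.norm_eq_abs, abs_of_nonneg hp.1]; exact hp.2
  rw [Measure.integral_compProd hint]
  have hg : Integrable (fun x => ∫ y, F (x, y) ∂(κ x)) ν := hint.integral_compProd
  have e : ∫ x, ∫ y, F (x, y) ∂(κ x) ∂ν - L = ∫ x, (∫ y, F (x, y) ∂(κ x) - L) ∂ν := by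
    rw [integral_sub hg (integrable_const _)]; simp
  have hb : Integrable (fun x => r + Gᶜ.indicator (fun _ => (1 : ℝ)) x) ν :=
    (integrable_const r).add ((integrable_const (1 : ℝ)).indicator hG.compl)
  have hval : ∫ x, (r + Gᶜ.indicator (fun _ => (1 : ℝ)) x) ∂ν = r + ν.real Gᶜ := by
    rw [integral_add (integrable_const r) ((integrable_const (1 : ℝ)).indicator hG.compl),
      integral_indicator hG.compl]
    simp
  rw [e, ← hval, ← Real.norm_eq_abs]
  refine norm_integral_le_of_norm_le hb ?_
  filter_upwards [h, Measure.ae_ae_of_ae_compProd hF1] with x hx hx1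
  by_cases hxG : x ∈ G
  · rw [Set.indicator_of_notMem (by simpa using hxG), add_zero]
    exact hx hxG
  · rw [Set.indicator_of_mem (by simpa using hxG)]
    have h0 : 0 ≤ ∫ y, F (x, y) ∂(κ x) := integral_nonneg_of_ae (by
      filter_upwards [hx1] with y hy using hy.1)
    have h1 : ∫ y, F (x, y) ∂(κ x) ≤ 1 := by
      have := integral_mono_of_nonneg (μ := κ x) (f := fun y => F (x, y)) (g := fun _ => (1 : ℝ))
        (by filter_upwards [hx1] with y hy using hy.1) (integrable_const _)
        (by filter_upwards [hx1] with y hy using hy.2)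
      simpa using this
    rw [Real.norm_eq_abs, abs_le]
    constructor <;> linarith [hL.1, hL.2]

end Disintegration

/-! ### A common risk bound for both algorithms. -/

section RandomKnots

/-- A strictly increasing vector of knots from `0` to `1`. -/
structure IsKnots {n : ℕ} (x : Fin (n + 2) → ℝ) : Prop where
  zero : x 0 = 0
  last : x (Fin.last _) = 1
  strictMono : StrictMono x

variable {n m : ℕ}

theorem IsKnots.mem_Icc {x : Fin (n + 2) → ℝ} (hx : IsKnots x) (j : Fin (n + 2)) :
    x j ∈ Set.Icc (0 : ℝ) 1 :=
  ⟨hx.zero ▸ hx.strictMono.monotone (Fin.zero_le j),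
    hx.last ▸ hx.strictMono.monotone (Fin.le_last j)⟩

theorem measurableSet_isKnots : MeasurableSet {x : Fin (n + 2) → ℝ | IsKnots x} := by
  have e : {x : Fin (n + 2) → ℝ | IsKnots x} = ({x | x 0 = 0} ∩ {x | x (Fin.last _) = 1}) ∩
      ⋂ j : Fin (n + 1), {x | x j.castSucc < x j.succ} := by
    ext x
    simp only [Set.mem_inter_iff, Set.mem_iInter, Set.mem_ofPred_eq]
    rw [← Fin.strictMono_iff_lt_succ]
    exact ⟨fun h => ⟨⟨h.1, h.2⟩, h.3⟩, fun h => ⟨h.1.1, h.1.2, h.2⟩⟩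
  rw [e]
  exact ((measurableSet_eq_fun (by fun_prop) (by fun_prop)).inter
    (measurableSet_eq_fun (by fun_prop) (by fun_prop))).inter
    (MeasurableSet.iInter fun j => measurableSet_lt (by fun_prop) (by fun_prop))

/-- A recipe producing a path of `[0,1]` from a vector of knots and a Dirichlet vector: the knots
are mapped by `knots`, the jumps are obtained by applying `jumps` to the Dirichlet vector, which has
parameters `param x` of total mass `θ`. -/
structure IsPathScheme (θ : ℝ) (knots : (Fin (n + 2) → ℝ) → Fin (n + 2) → ℝ)
    (jumps : (Fin m → ℝ) → Fin (n + 2) → ℝ) (param : (Fin (n + 2) → ℝ) → Fin m → ℝ) : Prop where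
  measurable_knots : Measurable knots
  measurable_jumps : Measurable jumps
  monotone : ∀ x, IsKnots x → Monotone (knots x)
  knots_zero : ∀ x, IsKnots x → knots x 0 = 0
  knots_last : ∀ x, IsKnots x → knots x (Fin.last _) = 1
  jumps_nonneg : ∀ z : Fin m → ℝ, (∀ i, 0 ≤ z i) → ∀ j, 0 ≤ jumps z j
  sum_jumps : ∀ z : Fin m → ℝ, (∀ i, 0 ≤ z i) → ∑ i, z i = 1 → ∑ j, jumps z j = 1
  param_pos : ∀ x, IsKnots x → ∀ i, 0 < param x i
  sum_param : ∀ x, IsKnots x → ∑ i, param x i = θ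

variable {Ω : Type*} [MeasurableSpace Ω] {P : Measure Ω} [IsProbabilityMeasure P]
  {U : Fin n → Ω → ℝ} {Y : Ω → Fin m → ℝ} {κ : Kernel (Fin (n + 2) → ℝ) (Fin m → ℝ)}
  {θ : ℝ} {knots : (Fin (n + 2) → ℝ) → Fin (n + 2) → ℝ} {jumps : (Fin m → ℝ) → Fin (n + 2) → ℝ}
  {param : (Fin (n + 2) → ℝ) → Fin m → ℝ} {Φ : ℝ → ℝ}

theorem ae_isKnots_sortedKnots (hind : iIndepFun U P)
    (hU : ∀ i, HasLaw (U i) (volume.restrict (Set.Icc (0 : ℝ) 1)) P) :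
    ∀ᵐ ω ∂P, IsKnots (sortedKnots fun i => U i ω) := by
  filter_upwards [ae_uniform_mem_Ioo hU, ae_uniform_injective hind hU] with ω h1 h2
  exact ⟨sortedKnots_zero _, sortedKnots_last _, strictMono_sortedKnots h1 h2⟩

theorem ae_map_isKnots (hind : iIndepFun U P)
    (hU : ∀ i, HasLaw (U i) (volume.restrict (Set.Icc (0 : ℝ) 1)) P) :
    ∀ᵐ x ∂(P.map fun ω => sortedKnots fun i => U i ω), IsKnots x :=
  (ae_map_iff (aemeasurable_sortedKnots hU) measurableSet_isKnots).mpr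
    (ae_isKnots_sortedKnots hind hU)

/-- The factorisation `hlaw` covers both algorithms: `κ` is the conditional distribution for BK and
a constant kernel for CDF. Through it, the Dirichlet vector lies almost surely in the simplex. -/
theorem IsPathScheme.ae_path_mem_Icc [NeZero m] [IsMarkovKernel κ]
    (hs : IsPathScheme θ knots jumps param) (hind : iIndepFun U P)
    (hU : ∀ i, HasLaw (U i) (volume.restrict (Set.Icc (0 : ℝ) 1)) P) (hY : AEMeasurable Y P)
    (hlaw : (P.map fun ω => (sortedKnots fun i => U i ω, Y ω))
      = (P.map fun ω => sortedKnots fun i => U i ω) ⊗ₘ κ)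
    (hκ : ∀ᵐ x ∂(P.map fun ω => sortedKnots fun i => U i ω), κ x = dirichletMeasure (param x)) :
    ∀ᵐ ω ∂P, ∀ t ∈ Set.Icc (0 : ℝ) 1,
      interpPath (knots (sortedKnots fun i => U i ω)) (jumps (Y ω)) t ∈ Set.Icc (0 : ℝ) 1 := by
  have hXm := aemeasurable_sortedKnots hU
  have := Measure.isProbabilityMeasure_map hXm
  have h1 : ∀ᵐ p ∂((P.map fun ω => sortedKnots fun i => U i ω) ⊗ₘ κ),
      (∀ i, 0 ≤ p.2 i) ∧ ∑ i, p.2 i = 1 := by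
    refine Measure.ae_compProd_of_ae_ae (measurable_snd measurableSet_simplex) ?_
    filter_upwards [hκ, ae_map_isKnots hind hU] with x hx hx1
    rw [hx]
    exact ae_dirichletMeasure (hs.param_pos x hx1)
  rw [← hlaw] at h1
  filter_upwards [ae_of_ae_map (hXm.prodMk hY) h1, ae_isKnots_sortedKnots hind hU] with ω h2 h3 t ht
  exact interpPath_mem_Icc (hs.monotone _ h3) (hs.knots_zero _ h3) (hs.knots_last _ h3)
    (hs.jumps_nonneg _ h2.1) (hs.sum_jumps _ h2.1 h2.2) ht

theorem abs_sub_le_one_of_mem_Icc {x y : ℝ} (hx : x ∈ Set.Icc (0 : ℝ) 1)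
    (hy : y ∈ Set.Icc (0 : ℝ) 1) : |x - y| ≤ 1 := by
  rw [abs_le]; constructor <;> linarith [hx.1, hx.2, hy.1, hy.2]

theorem IsPathScheme.memLp_and_integrable [NeZero m] [IsMarkovKernel κ]
    (hs : IsPathScheme θ knots jumps param) (hind : iIndepFun U P)
    (hU : ∀ i, HasLaw (U i) (volume.restrict (Set.Icc (0 : ℝ) 1)) P) (hY : AEMeasurable Y P)
    (hlaw : (P.map fun ω => (sortedKnots fun i => U i ω, Y ω))
      = (P.map fun ω => sortedKnots fun i => U i ω) ⊗ₘ κ)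
    (hκ : ∀ᵐ x ∂(P.map fun ω => sortedKnots fun i => U i ω), κ x = dirichletMeasure (param x))
    (hΦ : Continuous Φ) (hΦ1 : ∀ t, Φ t ∈ Set.Icc (0 : ℝ) 1) :
    (∀ᵐ ω ∂P, MemLp (fun t =>
      interpPath (knots (sortedKnots fun i => U i ω)) (jumps (Y ω)) t - Φ t) 2
        (volume.restrict (Set.Icc (0 : ℝ) 1))) ∧
    Integrable (fun ω => l2NormSq fun t =>
      interpPath (knots (sortedKnots fun i => U i ω)) (jumps (Y ω)) t - Φ t) P := by
  have hmem := hs.ae_path_mem_Icc hind hU hY hlaw hκ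
  constructor
  · filter_upwards [hmem] with ω hω
    refine MemLp.of_bound (Measurable.aestronglyMeasurable ?_) 1 ?_
    · exact (measurable_interpPath.comp (measurable_const.prodMk
        (measurable_const.prodMk measurable_id))).sub hΦ.measurable
    · filter_upwards [ae_restrict_mem measurableSet_Icc] with t ht
      exact abs_sub_le_one_of_mem_Icc (hω t ht) (hΦ1 t)
  · have hF := measurable_l2NormSq_interpPath hs.measurable_knots hs.measurable_jumps
      hΦ.measurable
    refine Integrable.of_bound (hF.comp_aemeasurable
      ((aemeasurable_sortedKnots hU).prodMk hY)).aestronglyMeasurable 1 ?_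
    filter_upwards [hmem] with ω hω
    have := l2NormSq_mem_Icc fun t ht => abs_sub_le_one_of_mem_Icc (hω t ht) (hΦ1 t)
    rw [Real.norm_eq_abs, abs_of_nonneg this.1]
    exact this.2

theorem limit_mem_Icc (hθ : 0 < θ) (hΦ : Continuous Φ) (hΦ1 : ∀ t, Φ t ∈ Set.Icc (0 : ℝ) 1) :
    1 / (1 + θ) * ∫ t in (0 : ℝ)..1, Φ t * (1 - Φ t) ∈ Set.Icc (0 : ℝ) 1 := by
  have h0 : 0 ≤ ∫ t in (0 : ℝ)..1, Φ t * (1 - Φ t) :=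
    intervalIntegral.integral_nonneg zero_le_one fun t _ =>
      mul_nonneg (hΦ1 t).1 (by linarith [(hΦ1 t).2])
  have h1 : ∫ t in (0 : ℝ)..1, Φ t * (1 - Φ t) ≤ ∫ t in (0 : ℝ)..1, (1 : ℝ) :=
    intervalIntegral.integral_mono_on zero_le_one
      (Continuous.intervalIntegrable (by fun_prop) _ _) (by simp) fun t _ => by
        nlinarith [(hΦ1 t).1, (hΦ1 t).2]
  simp only [intervalIntegral.integral_const, sub_zero, smul_eq_mul, mul_one] at h1
  have h2 : 1 / (1 + θ) ≤ 1 := by rw [div_le_one (by positivity)]; linarith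
  exact ⟨by positivity, mul_le_one₀ h2 h0 h1⟩

/-- The vector of knots is uniformly `ε`-close to the grid of step `1 / n`. -/
def IsCloseToGrid (ε : ℝ) (x : Fin (n + 2) → ℝ) : Prop :=
  ∀ j : Fin (n + 2), |x j - (j : ℕ) / n| ≤ ε

theorem measurableSet_isCloseToGrid (ε : ℝ) :
    MeasurableSet {x : Fin (n + 2) → ℝ | IsCloseToGrid ε x} := by
  have e : {x : Fin (n + 2) → ℝ | IsCloseToGrid ε x}
      = ⋂ j : Fin (n + 2), {x : Fin (n + 2) → ℝ | |x j - (j : ℕ) / n| ≤ ε} := by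
    ext x; simp [IsCloseToGrid]
  rw [e]
  exact MeasurableSet.iInter fun j => measurableSet_le (by fun_prop) (by fun_prop)

/-- The term `5 δ` is the fixed-knot estimate on knots close to the grid; the other term bounds the
probability of the remaining knots. -/
theorem IsPathScheme.abs_risk_sub_le [NeZero m] [IsMarkovKernel κ]
    (hs : IsPathScheme θ knots jumps param) (hind : iIndepFun U P)
    (hU : ∀ i, HasLaw (U i) (volume.restrict (Set.Icc (0 : ℝ) 1)) P) (hY : AEMeasurable Y P)
    (hlaw : (P.map fun ω => (sortedKnots fun i => U i ω, Y ω))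
      = (P.map fun ω => sortedKnots fun i => U i ω) ⊗ₘ κ)
    (hκ : ∀ᵐ x ∂(P.map fun ω => sortedKnots fun i => U i ω), κ x = dirichletMeasure (param x))
    (hΦ : Continuous Φ) (hΦ1 : ∀ t, Φ t ∈ Set.Icc (0 : ℝ) 1) (hθ : 0 < θ) {ε δ : ℝ} (hδ : 0 ≤ δ)
    {K : ℕ} (hK : 2 < ε * K) (hn : 1 ≤ ε * n)
    (h : ∀ x, IsKnots x → IsCloseToGrid ε x →
      ∀ t ∈ Set.Ico (0 : ℝ) 1, ∃ J J' : Finset (Fin m),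
        (∀ z : Fin m → ℝ, (∀ i, 0 ≤ z i) → ∑ i, z i = 1 →
          |interpPath (knots x) (jumps z) t - ∑ i ∈ J, z i| ≤ ∑ i ∈ J', z i) ∧
        |(∑ i ∈ J, param x i) / ∑ i, param x i - Φ t| ≤ δ ∧
        (∑ i ∈ J', param x i) / ∑ i, param x i ≤ δ) :
    |∫ ω, (l2NormSq fun t =>
        interpPath (knots (sortedKnots fun i => U i ω)) (jumps (Y ω)) t - Φ t) ∂P
      - 1 / (1 + θ) * ∫ t in (0 : ℝ)..1, Φ t * (1 - Φ t)|
      ≤ 5 * δ + (K + 1) * (n / (n * (ε / 2)) ^ 2) := by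
  have hXm := aemeasurable_sortedKnots hU
  have := Measure.isProbabilityMeasure_map hXm
  have hF := measurable_l2NormSq_interpPath hs.measurable_knots hs.measurable_jumps hΦ.measurable
  have hF1 : ∀ᵐ p ∂((P.map fun ω => sortedKnots fun i => U i ω) ⊗ₘ κ),
      (l2NormSq fun t => interpPath (knots p.1) (jumps p.2) t - Φ t) ∈ Set.Icc (0 : ℝ) 1 := by
    rw [← hlaw]
    refine (ae_map_iff (hXm.prodMk hY) (hF measurableSet_Icc)).mpr ?_
    filter_upwards [hs.ae_path_mem_Icc hind hU hY hlaw hκ] with ω hω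
    exact l2NormSq_mem_Icc fun t ht => abs_sub_le_one_of_mem_Icc (hω t ht) (hΦ1 t)
  have hmain := abs_integral_compProd_sub_le hF hF1 (measurableSet_isCloseToGrid ε)
    (r := 5 * δ) (by positivity) (limit_mem_Icc hθ hΦ hΦ1) (by
      filter_upwards [hκ, ae_map_isKnots hind hU] with x hx hx1 hx2
      rw [hx]
      have := abs_integral_l2NormSq_sub_le (hs.param_pos x hx1)
        (W := fun z t => interpPath (knots x) (jumps z) t)
        (measurable_interpPath.comp (measurable_const.prodMk
          ((hs.measurable_jumps.comp measurable_fst).prodMk measurable_snd)))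
        hΦ hΦ1 (h x hx1 hx2)
      rwa [hs.sum_param x hx1] at this)
  rw [← hlaw, integral_map (hXm.prodMk hY) hF.aestronglyMeasurable] at hmain
  refine hmain.trans (add_le_add le_rfl ?_)
  rw [Measure.real, Measure.map_apply_of_aemeasurable hXm (measurableSet_isCloseToGrid ε).compl]
  exact ENNReal.toReal_le_of_le_ofReal (by positivity) (measure_not_close_le hind hU hK hn)

end RandomKnots

/-! ### Warping functions -/

section Warping

variable {φ : ℝ → ℝ}

/-- The continuous extension of `φ|[0,1]` to the line by constants. -/
noncomputable def clampExtend (φ : ℝ → ℝ) : ℝ → ℝ :=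
  Set.IccExtend (zero_le_one (α := ℝ)) fun x => φ x

theorem clampExtend_of_mem {t : ℝ} (ht : t ∈ Set.Icc (0 : ℝ) 1) : clampExtend φ t = φ t :=
  Set.IccExtend_of_mem _ _ ht

theorem IsACWarping.mem_Icc (hφ : IsACWarping φ) {t : ℝ} (ht : t ∈ Set.Icc (0 : ℝ) 1) :
    φ t ∈ Set.Icc (0 : ℝ) 1 := by
  have h := hφ.strictMonoOn.monotoneOn
  exact ⟨hφ.map_zero ▸ h ⟨le_rfl, zero_le_one⟩ ht ht.1,
    hφ.map_one ▸ h ht ⟨zero_le_one, le_rfl⟩ ht.2⟩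

theorem IsACWarping.continuous_clampExtend (hφ : IsACWarping φ) : Continuous (clampExtend φ) :=
  hφ.continuousOn.domRestrict.Icc_extend'

theorem IsACWarping.clampExtend_mem_Icc (hφ : IsACWarping φ) (t : ℝ) :
    clampExtend φ t ∈ Set.Icc (0 : ℝ) 1 :=
  hφ.mem_Icc (Set.projIcc (0 : ℝ) 1 zero_le_one t).2

theorem IsACWarping.exists_eq (hφ : IsACWarping φ) {s : ℝ} (hs : s ∈ Set.Icc (0 : ℝ) 1) :
    ∃ t ∈ Set.Icc (0 : ℝ) 1, φ t = s :=
  intermediate_value_Icc zero_le_one hφ.continuousOn (by rwa [hφ.map_zero, hφ.map_one])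

theorem IsACWarping.warpInv_mem_Icc (hφ : IsACWarping φ) {s : ℝ} (hs : s ∈ Set.Icc (0 : ℝ) 1) :
    warpInv φ s ∈ Set.Icc (0 : ℝ) 1 :=
  Function.invFunOn_mem (hφ.exists_eq hs)

theorem IsACWarping.map_warpInv (hφ : IsACWarping φ) {s : ℝ} (hs : s ∈ Set.Icc (0 : ℝ) 1) :
    φ (warpInv φ s) = s :=
  Function.invFunOn_eq (hφ.exists_eq hs)

/-- A Galois connection, used to turn the position of `t` among the warped knots into that of `φ t`
among the original ones. -/
theorem IsACWarping.warpInv_le_iff (hφ : IsACWarping φ) {s t : ℝ} (hs : s ∈ Set.Icc (0 : ℝ) 1)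
    (ht : t ∈ Set.Icc (0 : ℝ) 1) : warpInv φ s ≤ t ↔ s ≤ φ t := by
  rw [← hφ.strictMonoOn.le_iff_le (hφ.warpInv_mem_Icc hs) ht, hφ.map_warpInv hs]

theorem IsACWarping.warpInv_map (hφ : IsACWarping φ) {t : ℝ} (ht : t ∈ Set.Icc (0 : ℝ) 1) :
    warpInv φ (φ t) = t :=
  hφ.strictMonoOn.injOn (hφ.warpInv_mem_Icc (hφ.mem_Icc ht)) ht
    (hφ.map_warpInv (hφ.mem_Icc ht))

theorem IsACWarping.warpInv_zero (hφ : IsACWarping φ) : warpInv φ 0 = 0 := by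
  have := hφ.warpInv_map (t := 0) ⟨le_rfl, zero_le_one⟩
  rwa [hφ.map_zero] at this

theorem IsACWarping.warpInv_one (hφ : IsACWarping φ) : warpInv φ 1 = 1 := by
  have := hφ.warpInv_map (t := 1) ⟨zero_le_one, le_rfl⟩
  rwa [hφ.map_one] at this

theorem IsACWarping.monotoneOn_warpInv (hφ : IsACWarping φ) :
    MonotoneOn (warpInv φ) (Set.Icc 0 1) := fun s hs t ht hst => by
  rw [hφ.warpInv_le_iff hs (hφ.warpInv_mem_Icc ht), hφ.map_warpInv ht]; exact hst

/-- Monotonicity on the whole line supplies the measurability of the CDF knots. -/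
theorem IsACWarping.monotone_clampExtend_warpInv (hφ : IsACWarping φ) :
    Monotone (clampExtend (warpInv φ)) := fun _ _ hst =>
  hφ.monotoneOn_warpInv (Set.projIcc (0 : ℝ) 1 zero_le_one _).2
    (Set.projIcc (0 : ℝ) 1 zero_le_one _).2 (Set.monotone_projIcc _ hst)

end Warping

/-! ### The path schemes of the two algorithms -/

section BK

variable {n : ℕ}

theorem sum_filter_castSucc_lt_succ (g : Fin (n + 1) → ℝ) (j : Fin (n + 1)) :
    ∑ k ∈ Finset.univ.filter (fun k => k.castSucc < j.succ), g k
      = ∑ k ∈ Finset.univ.filter (fun k : Fin (n + 1) => k.castSucc < j.castSucc), g k + g j := by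
  have : Finset.univ.filter (fun k : Fin (n + 1) => k.castSucc < j.succ)
      = insert j (Finset.univ.filter fun k : Fin (n + 1) => k.castSucc < j.castSucc) := by
    ext k
    simp only [Finset.mem_filter, Finset.mem_univ, true_and, Finset.mem_insert, Fin.lt_def,
      Fin.ext_iff, Fin.val_succ, Fin.val_castSucc]
    omega
  rw [this, Finset.sum_insert (by simp), add_comm]

theorem sum_filter_castSucc_lt_sub (f : Fin (n + 2) → ℝ) (j : Fin (n + 2)) :
    ∑ k ∈ Finset.univ.filter (fun k : Fin (n + 1) => k.castSucc < j),
      (f k.succ - f k.castSucc) = f j - f 0 := by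
  induction j using Fin.induction with
  | zero => simp
  | succ j ih => rw [sum_filter_castSucc_lt_succ, ih]; ring

theorem cumSum_cons_zero (z : Fin (n + 1) → ℝ) (j : Fin (n + 2)) :
    cumSum (Fin.cons (α := fun _ => ℝ) 0 z) j
      = ∑ k ∈ Finset.univ.filter (fun k : Fin (n + 1) => k.castSucc < j), z k := by
  induction j using Fin.induction with
  | zero =>
    have : Finset.Iic (0 : Fin (n + 2)) = {0} := by ext k; simp
    simp [cumSum, this]
  | succ j ih => rw [cumSum_succ, ih, sum_filter_castSucc_lt_succ, Fin.cons_succ]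

/-- Telescoping; hence the conditional mean of the BK path at `U*ⱼ` is exactly `φ (U*ⱼ)`. -/
theorem sum_bkParam (θ : ℝ) (φ : ℝ → ℝ) (x : Fin (n + 2) → ℝ) (j : Fin (n + 2)) :
    ∑ k ∈ Finset.univ.filter (fun k : Fin (n + 1) => k.castSucc < j), bkParam θ φ x k
      = θ * (φ (x j) - φ (x 0)) := by
  simp only [bkParam, ← Finset.mul_sum]
  rw [sum_filter_castSucc_lt_sub (fun k => φ (x k))]

theorem sum_univ_bkParam {θ : ℝ} {φ : ℝ → ℝ} (hφ : IsACWarping φ) {x : Fin (n + 2) → ℝ}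
    (hx : IsKnots x) : ∑ k, bkParam θ φ x k = θ := by
  have := sum_bkParam θ φ x (Fin.last _)
  rw [hx.zero, hx.last, hφ.map_zero, hφ.map_one, sub_zero, mul_one] at this
  rwa [Finset.filter_true_of_mem fun k _ => Fin.castSucc_lt_last k] at this

theorem isPathScheme_bk {θ : ℝ} (hθ : 0 < θ) {φ : ℝ → ℝ} (hφ : IsACWarping φ) :
    IsPathScheme (n := n) θ id (Fin.cons (α := fun _ => ℝ) 0) (bkParam θ φ) where
  measurable_knots := measurable_id
  measurable_jumps := by
    rw [measurable_pi_iff]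
    intro j
    cases j using Fin.cases with
    | zero => simp
    | succ j => simpa using measurable_pi_apply j
  monotone x hx := hx.strictMono.monotone
  knots_zero x hx := hx.zero
  knots_last x hx := hx.last
  jumps_nonneg z hz j := by
    cases j using Fin.cases with
    | zero => simp
    | succ j => simpa using hz j
  sum_jumps z _ hz1 := by rw [Fin.sum_univ_succ]; simpa using hz1
  param_pos x hx i := mul_pos hθ (sub_pos.mpr
    (hφ.strictMonoOn (hx.mem_Icc _) (hx.mem_Icc _) (hx.strictMono Fin.castSucc_lt_succ)))
  sum_param x hx := sum_univ_bkParam hφ hx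

theorem bk_path_close {θ : ℝ} (hθ : 0 < θ) {φ : ℝ → ℝ} (hφ : IsACWarping φ) {ε δ : ℝ}
    (hδ : ∀ s ∈ Set.Icc (0 : ℝ) 1, ∀ t ∈ Set.Icc (0 : ℝ) 1, |s - t| ≤ 3 * ε → |φ s - φ t| ≤ δ)
    (hn : 1 ≤ ε * n) (hn0 : 0 < n) {x : Fin (n + 2) → ℝ} (hx : IsKnots x)
    (hxε : IsCloseToGrid ε x) {t : ℝ} (ht : t ∈ Set.Ico (0 : ℝ) 1) :
    ∃ J J' : Finset (Fin (n + 1)),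
      (∀ z : Fin (n + 1) → ℝ, (∀ i, 0 ≤ z i) → ∑ i, z i = 1 →
        |interpPath (id x) (Fin.cons (α := fun _ => ℝ) 0 z) t - ∑ i ∈ J, z i|
          ≤ ∑ i ∈ J', z i) ∧
      |(∑ i ∈ J, bkParam θ φ x i) / ∑ i, bkParam θ φ x i - clampExtend φ t| ≤ δ ∧
      (∑ i ∈ J', bkParam θ φ x i) / ∑ i, bkParam θ φ x i ≤ δ := by
  obtain ⟨j, hj⟩ := exists_mem_Ico_knots hx.zero hx.last ht
  have hn' : (0 : ℝ) < n := by exact_mod_cast hn0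
  have hinv : (1 : ℝ) / n ≤ ε := by rw [div_le_iff₀ hn']; exact hn
  -- One `ε` for each knot's distance to the grid, and one for the grid step `1 / n`.
  have hgap : x j.succ - x j.castSucc ≤ 3 * ε := by
    have h1 := abs_le.mp (hxε j.succ)
    have h2 := abs_le.mp (hxε j.castSucc)
    have h3 : (((j : ℕ) + 1 : ℕ) : ℝ) / n = (j : ℕ) / n + 1 / n := by push_cast; ring
    rw [Fin.val_succ, h3] at h1
    rw [Fin.val_castSucc] at h2
    linarith [h1.2, h2.1]
  -- `J` collects the cells left of the one containing `t`; the jump across that cell bounds the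
  -- interpolation error.
  refine ⟨Finset.univ.filter fun k => k.castSucc < j.castSucc, {j}, fun z hz hz1 => ?_, ?_, ?_⟩
  · rw [id, interpPath_eq hx.strictMono.monotone _ ht.2.ne hj, cumSum_cons_zero, Fin.cons_succ,
      add_sub_cancel_left, Finset.sum_singleton]
    have w := interpWeight_mem_Icc hj
    rw [abs_of_nonneg (mul_nonneg (hz j) w.1)]
    exact mul_le_of_le_one_right (hz j) w.2
  · rw [sum_bkParam, sum_univ_bkParam hφ hx, hx.zero, hφ.map_zero, sub_zero,
      mul_div_cancel_left₀ _ hθ.ne', clampExtend_of_mem ⟨ht.1, ht.2.le⟩]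
    refine hδ _ (hx.mem_Icc _) _ ⟨ht.1, ht.2.le⟩ ?_
    rw [abs_le]
    constructor <;> linarith [hj.1, hj.2]
  · rw [Finset.sum_singleton, sum_univ_bkParam hφ hx, bkParam, mul_div_cancel_left₀ _ hθ.ne']
    refine (le_abs_self _).trans (hδ _ (hx.mem_Icc _) _ (hx.mem_Icc _) ?_)
    rw [abs_le]
    constructor <;> linarith [hj.1, hj.2]

end BK

/-! ### The CDF algorithm. -/

section CDF

variable {n : ℕ}

theorem extendZero_of_nonpos (z : Fin n → ℝ) {k : ℤ} (hk : k ≤ 0) : extendZero z k = 0 :=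
  dif_neg (by omega)

theorem extendZero_nonneg {z : Fin n → ℝ} (hz : ∀ i, 0 ≤ z i) (k : ℤ) : 0 ≤ extendZero z k := by
  unfold extendZero; split_ifs
  · exact hz _
  · exact le_rfl

theorem measurable_extendZero (k : ℤ) : Measurable fun z : Fin n → ℝ => extendZero z k := by
  unfold extendZero; split_ifs
  · exact measurable_pi_apply _
  · exact measurable_const

theorem sum_filter_val_lt_succ (z : Fin n → ℝ) (i : ℕ) :
    ∑ k ∈ Finset.univ.filter (fun k : Fin n => (k : ℕ) < i + 1), z k
      = ∑ k ∈ Finset.univ.filter (fun k : Fin n => (k : ℕ) < i), z k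
        + extendZero z ((i : ℤ) + 1) := by
  by_cases hi : i < n
  · have h1 : extendZero z ((i : ℤ) + 1) = z ⟨i, hi⟩ := by
      rw [extendZero, dif_pos (by omega)]
      congr 1
      ext
      simp
    have h2 : Finset.univ.filter (fun k : Fin n => (k : ℕ) < i + 1)
        = insert ⟨i, hi⟩ (Finset.univ.filter fun k : Fin n => (k : ℕ) < i) := by
      ext k
      simp only [Finset.mem_filter, Finset.mem_univ, true_and, Finset.mem_insert, Fin.ext_iff]
      omega
    rw [h1, h2, Finset.sum_insert (by simp), add_comm]
  · have h1 : extendZero z ((i : ℤ) + 1) = 0 := dif_neg (by omega)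
    rw [h1, add_zero]
    congr 1
    ext k
    simp only [Finset.mem_filter, Finset.mem_univ, true_and]
    omega

/-- At `i = 0` truncated subtraction empties both sums and `β₀ = 0`, so the boundary needs no
separate treatment later. -/
theorem sum_filter_val_lt_eq_pred (z : Fin n → ℝ) (i : ℕ) :
    ∑ k ∈ Finset.univ.filter (fun k : Fin n => (k : ℕ) < i), z k
      = ∑ k ∈ Finset.univ.filter (fun k : Fin n => (k : ℕ) < i - 1), z k
        + extendZero z (i : ℤ) := by
  cases i with
  | zero => simp [extendZero_of_nonpos]
  | succ i => simpa using sum_filter_val_lt_succ z i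

/-- The index `k : Fin n` stands for `βₖ₊₁`, so the two sums are `β₁ + … + βⱼ` and `β₁ + … + βⱼ₋₁`:
the parameter `p` only affects the weight of `βⱼ`. -/
theorem cumSum_cdfJumps (p : ℝ) (z : Fin n → ℝ) (j : Fin (n + 2)) :
    cumSum (cdfJumps p z) j
      = (1 - p) * ∑ k ∈ Finset.univ.filter (fun k : Fin n => (k : ℕ) < j), z k
        + p * ∑ k ∈ Finset.univ.filter (fun k : Fin n => (k : ℕ) < j - 1), z k := by
  induction j using Fin.induction with
  | zero =>
    have : Finset.Iic (0 : Fin (n + 2)) = {0} := by ext k; simp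
    simp [cumSum, this, cdfJumps, extendZero_of_nonpos]
  | succ j ih =>
    rw [cumSum_succ, ih, Fin.val_succ, Fin.val_castSucc, sum_filter_val_lt_succ,
      Nat.add_sub_cancel]
    have h := sum_filter_val_lt_eq_pred z j
    simp only [cdfJumps, Fin.val_succ]
    push_cast
    rw [add_sub_cancel_right]
    linear_combination (-p) * h

theorem sum_cdfJumps (p : ℝ) (z : Fin n → ℝ) : ∑ j, cdfJumps p z j = ∑ i, z i := by
  have h := cumSum_cdfJumps p z (Fin.last _)
  have e : Finset.Iic (Fin.last (n + 1)) = Finset.univ := by ext; simp [Fin.le_last]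
  have e1 : Finset.univ.filter (fun k : Fin n => (k : ℕ) < n + 1) = Finset.univ := by
    ext k; simp
  have e2 : Finset.univ.filter (fun k : Fin n => (k : ℕ) < n) = Finset.univ := by ext k; simp
  rw [cumSum, e, Fin.val_last, Nat.add_sub_cancel, e1, e2] at h
  rw [h]; ring

/-- A scheme needs a knot map measurable on all vectors, whereas `warpInv φ` is controlled only on
`[0, 1]`; hence `clampExtend`, which changes nothing on genuine knots. -/
theorem isPathScheme_cdf {p θ : ℝ} (hp : p ∈ Set.Ioo (0 : ℝ) 1) (hθ : 0 < θ) {φ : ℝ → ℝ}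
    (hφ : IsACWarping φ) (hn0 : 0 < n) :
    IsPathScheme (n := n) θ (fun x j => clampExtend (warpInv φ) (x j)) (cdfJumps p)
      (fun _ (_ : Fin n) => θ / n) where
  measurable_knots := measurable_pi_lambda _ fun j =>
    hφ.monotone_clampExtend_warpInv.measurable.comp (measurable_pi_apply j)
  measurable_jumps := measurable_pi_lambda _ fun j =>
    ((measurable_extendZero _).const_mul _).add ((measurable_extendZero _).const_mul _)
  monotone x hx := hφ.monotone_clampExtend_warpInv.comp hx.strictMono.monotone
  knots_zero x hx := by
    rw [hx.zero, clampExtend_of_mem ⟨le_rfl, zero_le_one⟩, hφ.warpInv_zero]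
  knots_last x hx := by
    rw [hx.last, clampExtend_of_mem ⟨zero_le_one, le_rfl⟩, hφ.warpInv_one]
  jumps_nonneg z hz j := add_nonneg
    (mul_nonneg (by linarith [hp.2]) (extendZero_nonneg hz _))
    (mul_nonneg hp.1.le (extendZero_nonneg hz _))
  sum_jumps z _ hz1 := by rw [sum_cdfJumps, hz1]
  param_pos _ _ _ := div_pos hθ (by exact_mod_cast hn0)
  sum_param _ _ := by
    have : (n : ℝ) ≠ 0 := by exact_mod_cast hn0.ne'
    simp; field_simp

theorem cdf_path_close {p θ : ℝ} (hp : p ∈ Set.Ioo (0 : ℝ) 1) (hθ : 0 < θ) {φ : ℝ → ℝ}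
    (hφ : IsACWarping φ) (hn0 : 0 < n) {ε : ℝ} (hn : 1 ≤ ε * n) {x : Fin (n + 2) → ℝ}
    (hx : IsKnots x) (hxε : IsCloseToGrid ε x) {t : ℝ} (ht : t ∈ Set.Ico (0 : ℝ) 1) :
    ∃ J J' : Finset (Fin n),
      (∀ z : Fin n → ℝ, (∀ i, 0 ≤ z i) → ∑ i, z i = 1 →
        |interpPath (fun j => clampExtend (warpInv φ) (x j)) (cdfJumps p z) t - ∑ i ∈ J, z i|
          ≤ ∑ i ∈ J', z i) ∧
      |(∑ _i ∈ J, θ / n) / ∑ _i : Fin n, θ / n - clampExtend φ t| ≤ 2 * ε ∧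
      (∑ _i ∈ J', θ / n) / ∑ _i : Fin n, θ / n ≤ 2 * ε := by
  have hs := isPathScheme_cdf (n := n) hp hθ hφ hn0
  have hn' : (0 : ℝ) < n := by exact_mod_cast hn0
  have hinv : (1 : ℝ) / n ≤ ε := by rw [div_le_iff₀ hn']; exact hn
  have ht' : t ∈ Set.Icc (0 : ℝ) 1 := ⟨ht.1, ht.2.le⟩
  have hmass : ∀ J : Finset (Fin n), (∑ _i ∈ J, θ / n) / ∑ _i : Fin n, θ / n = J.card / n := by
    intro J
    rw [hs.sum_param x hx, Finset.sum_const, nsmul_eq_mul]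
    field_simp
  obtain ⟨j, hj⟩ := exists_mem_Ico_knots
    (y := fun j => clampExtend (warpInv φ) (x j)) (hs.knots_zero x hx) (hs.knots_last x hx) ht
  -- Applying `φ` undoes the warping of the knots, so `φ t` is compared with `j / n` without any
  -- modulus of continuity.
  have hφt : φ t ∈ Set.Ico (x j.castSucc) (x j.succ) := by
    rw [clampExtend_of_mem (hx.mem_Icc _), clampExtend_of_mem (hx.mem_Icc _)] at hj
    exact ⟨(hφ.warpInv_le_iff (hx.mem_Icc _) ht').mp hj.1,
      not_le.mp fun h => not_le.mpr hj.2 ((hφ.warpInv_le_iff (hx.mem_Icc _) ht').mpr h)⟩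
  -- `J` corresponds to `β₁, …, βⱼ`, and `J'` to `βⱼ` and `βⱼ₊₁`, whose mass is at most `2 / n ≤ 2
  -- ε`.
  refine ⟨Finset.univ.filter fun k => (k : ℕ) < j,
    Finset.univ.filter fun k => (k : ℕ) < j + 1 ∧ ¬ (k : ℕ) < j - 1, fun z hz hz1 => ?_, ?_, ?_⟩
  · rw [interpPath_eq (hs.monotone x hx) _ ht.2.ne hj, cumSum_cdfJumps, Fin.val_castSucc]
    have w := interpWeight_mem_Icc hj
    set l := (t - clampExtend (warpInv φ) (x j.castSucc)) /
      (clampExtend (warpInv φ) (x j.succ) - clampExtend (warpInv φ) (x j.castSucc))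
    have hJ' : ∑ k ∈ Finset.univ.filter (fun k : Fin n => (k : ℕ) < j + 1 ∧ ¬ (k : ℕ) < j - 1), z k
        = extendZero z (j : ℕ) + extendZero z ((j : ℕ) + 1) := by
      have h1 := sum_filter_val_lt_succ z j
      have h2 := sum_filter_val_lt_eq_pred z j
      have h3 := Finset.sum_filter_add_sum_filter_not
        (Finset.univ.filter fun k : Fin n => (k : ℕ) < j + 1) (fun k => (k : ℕ) < j - 1) z
      rw [Finset.filter_filter, Finset.filter_filter] at h3
      have h4 : Finset.univ.filter (fun k : Fin n => (k : ℕ) < j + 1 ∧ (k : ℕ) < j - 1)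
          = Finset.univ.filter (fun k : Fin n => (k : ℕ) < j - 1) := by
        ext k; simp only [Finset.mem_filter, Finset.mem_univ, true_and]; omega
      rw [h4] at h3
      linarith
    rw [hJ', sum_filter_val_lt_eq_pred z j]
    have e0 := extendZero_nonneg hz ((j : ℕ) : ℤ)
    have e1 := extendZero_nonneg hz (((j : ℕ) : ℤ) + 1)
    simp only [cdfJumps, Fin.val_succ]
    push_cast
    rw [add_sub_cancel_right]
    set s := ∑ k ∈ Finset.univ.filter (fun k : Fin n => (k : ℕ) < j - 1), z k
    set u := extendZero z ((j : ℕ) : ℤ)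
    set v := extendZero z (((j : ℕ) : ℤ) + 1)
    have hp0 := hp.1.le
    have hp1 : 0 ≤ 1 - p := by linarith [hp.2]
    have hl1 : 0 ≤ 1 - l := by linarith [w.2]
    have b1 : 0 ≤ p * (1 - l) * u := by positivity
    have b2 : p * (1 - l) ≤ 1 := mul_le_one₀ hp.2.le hl1 (by linarith [w.1])
    have b3 : 0 ≤ (1 - p) * l * v := mul_nonneg (mul_nonneg hp1 w.1) e1
    have b4 : (1 - p) * l ≤ 1 := mul_le_one₀ (by linarith) w.1 w.2
    have b5 := mul_le_mul_of_nonneg_right b2 e0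
    have b6 := mul_le_mul_of_nonneg_right b4 e1
    -- Here `u = βⱼ` and `v = βⱼ₊₁` enter with opposite signs and weights in `[0, 1]`.
    have e : (1 - p) * (s + u) + p * s + ((1 - p) * v + p * u) * l - (s + u)
        = (1 - p) * l * v - p * (1 - l) * u := by ring
    rw [e, abs_le]
    constructor <;> linarith
  · rw [hmass, clampExtend_of_mem ht']
    have hc : (Finset.univ.filter fun k : Fin n => (k : ℕ) < j).card = j := by
      rw [Fin.card_filter_val_lt]; omega
    rw [hc]
    have h1 := abs_le.mp (hxε j.succ)
    have h2 := abs_le.mp (hxε j.castSucc)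
    have h3 : (((j : ℕ) + 1 : ℕ) : ℝ) / n = (j : ℕ) / n + 1 / n := by push_cast; ring
    rw [Fin.val_succ, h3] at h1
    rw [Fin.val_castSucc] at h2
    rw [abs_le]
    constructor <;> linarith [hφt.1, hφt.2, h1.1, h1.2, h2.1, h2.2]
  · rw [hmass]
    have hc : (Finset.univ.filter fun k : Fin n =>
        (k : ℕ) < j + 1 ∧ ¬ (k : ℕ) < j - 1).card ≤ 2 := by
      calc _ = ((Finset.univ.filter fun k : Fin n =>
            (k : ℕ) < j + 1 ∧ ¬ (k : ℕ) < j - 1).map Fin.valEmbedding).card :=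
            (Finset.card_map _).symm
        _ ≤ (Finset.Ico ((j : ℕ) - 1) (j + 1)).card := by
            refine Finset.card_le_card fun k hk => ?_
            simp only [Finset.mem_map, Finset.mem_filter, Finset.mem_univ, true_and,
              Fin.valEmbedding_apply] at hk
            obtain ⟨i, hi, rfl⟩ := hk
            rw [Finset.mem_Ico]; omega
        _ ≤ 2 := by rw [Nat.card_Ico]; omega
    have hc' : ((Finset.univ.filter fun k : Fin n =>
        (k : ℕ) < j + 1 ∧ ¬ (k : ℕ) < j - 1).card : ℝ) ≤ 2 := by exact_mod_cast hc
    calc _ ≤ (2 : ℝ) / n := by gcongr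
      _ = 2 * (1 / n) := by ring
      _ ≤ 2 * ε := by linarith

end CDF

/-! ### Convergence of the risks -/

theorem tendsto_of_forall_abs_sub_le {R : ℕ → ℝ} {L : ℝ}
    (h : ∀ η > 0, ∃ C : ℝ, ∃ ε > (0 : ℝ), ∀ n : ℕ, 1 ≤ n → 1 ≤ ε * n →
      |R n - L| ≤ 5 * η + C * (n / (n * (ε / 2)) ^ 2)) :
    Tendsto R atTop (𝓝 L) := by
  rw [Metric.tendsto_atTop']
  intro r hr
  -- Then `5 η = r / 2`, and the other half of `r` is left for `4 C / (ε ^ 2 n)`, which tends to `0`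
  -- because `C` and `ε` are fixed before `n`.
  obtain ⟨C, ε, hε, hb⟩ := h (r / 10) (by positivity)
  have h1 : Tendsto (fun n : ℕ => C * (4 / ε ^ 2) / (n : ℝ)) atTop (𝓝 0) :=
    tendsto_const_div_atTop_nhds_zero_nat _
  obtain ⟨N, hN⟩ := exists_nat_gt (1 / ε)
  obtain ⟨M, hM⟩ := eventually_atTop.mp (h1.eventually (gt_mem_nhds (half_pos hr)))
  refine ⟨max (max N M) 1, fun n hn => ?_⟩
  have hnN : N ≤ n := ((le_max_left _ _).trans (le_max_left _ _)).trans hn.le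
  have hnM : M ≤ n := ((le_max_right _ _).trans (le_max_left _ _)).trans hn.le
  have hn1 : 1 ≤ n := (le_max_right _ _).trans hn.le
  have hn0 : (0 : ℝ) < n := by exact_mod_cast hn1
  have hεn : 1 ≤ ε * n := by
    have : (N : ℝ) ≤ n := by exact_mod_cast hnN
    rw [div_lt_iff₀ hε] at hN
    nlinarith
  have e : C * ((n : ℝ) / (n * (ε / 2)) ^ 2) = C * (4 / ε ^ 2) / n := by field_simp; norm_num
  have := hb n hn1 hεn
  rw [e] at this
  rw [Real.dist_eq]
  linarith [hM n hnM]

theorem integral_clampExtend_mul {φ : ℝ → ℝ} :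
    ∫ t in (0 : ℝ)..1, clampExtend φ t * (1 - clampExtend φ t)
      = ∫ t in (0 : ℝ)..1, φ t * (1 - φ t) :=
  intervalIntegral.integral_congr fun t ht => by
    rw [Set.uIcc_of_le zero_le_one] at ht
    simp only [clampExtend_of_mem ht]

theorem l2NormSq_sub_clampExtend (w φ : ℝ → ℝ) :
    (l2NormSq fun t => w t - clampExtend φ t) = l2NormSq fun t => w t - φ t :=
  l2NormSq_congr fun t ht => by rw [clampExtend_of_mem ht]

theorem memLp_sub_clampExtend {w φ : ℝ → ℝ}
    (h : MemLp (fun t => w t - clampExtend φ t) 2 (volume.restrict (Set.Icc (0 : ℝ) 1))) :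
    MemLp (fun t => w t - φ t) 2 (volume.restrict (Set.Icc (0 : ℝ) 1)) := by
  refine h.ae_eq ?_
  filter_upwards [ae_restrict_mem measurableSet_Icc] with t ht
  rw [clampExtend_of_mem ht]

section BK

variable {Ω : Type*} [MeasurableSpace Ω] {P : Measure Ω} [IsProbabilityMeasure P] {n : ℕ}
  {θ : ℝ} {φ : ℝ → ℝ} {U : Fin n → Ω → ℝ} {α : Ω → Fin (n + 1) → ℝ}

theorem IsBKSample.memLp_and_integrable (h : IsBKSample P θ φ U α) (hθ : 0 < θ)
    (hφ : IsACWarping φ) :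
    (∀ᵐ ω ∂P, MemLp (fun t => bkPath (fun i => U i ω) (α ω) t - φ t) 2
      (volume.restrict (Set.Icc (0 : ℝ) 1))) ∧
    Integrable (fun ω => l2NormSq fun t => bkPath (fun i => U i ω) (α ω) t - φ t) P := by
  obtain ⟨h1, h2⟩ := (isPathScheme_bk hθ hφ).memLp_and_integrable h.indep h.uniform h.aemeasurable
    (compProd_map_condDistrib h.aemeasurable).symm h.dirichlet hφ.continuous_clampExtend
    hφ.clampExtend_mem_Icc
  simp only [l2NormSq_sub_clampExtend] at h2
  exact ⟨h1.mono fun ω hω => memLp_sub_clampExtend hω, h2⟩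

theorem IsBKSample.abs_risk_sub_le (h : IsBKSample P θ φ U α) (hθ : 0 < θ)
    (hφ : IsACWarping φ) {ε δ : ℝ} (hδ0 : 0 ≤ δ)
    (hδ : ∀ s ∈ Set.Icc (0 : ℝ) 1, ∀ t ∈ Set.Icc (0 : ℝ) 1, |s - t| ≤ 3 * ε → |φ s - φ t| ≤ δ)
    {K : ℕ} (hK : 2 < ε * K) (hn : 1 ≤ ε * n) (hn0 : 0 < n) :
    |∫ ω, (l2NormSq fun t => bkPath (fun i => U i ω) (α ω) t - φ t) ∂P
      - 1 / (1 + θ) * ∫ t in (0 : ℝ)..1, φ t * (1 - φ t)|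
      ≤ 5 * δ + (K + 1) * (n / (n * (ε / 2)) ^ 2) := by
  have := (isPathScheme_bk hθ hφ).abs_risk_sub_le h.indep h.uniform h.aemeasurable
    (compProd_map_condDistrib h.aemeasurable).symm h.dirichlet hφ.continuous_clampExtend
    hφ.clampExtend_mem_Icc hθ hδ0 hK hn
    fun x hx hxε t ht => bk_path_close hθ hφ hδ hn hn0 hx hxε ht
  simp only [l2NormSq_sub_clampExtend, integral_clampExtend_mul] at this
  exact this

end BK

section CDF

variable {Ω : Type*} [MeasurableSpace Ω] {P : Measure Ω} [IsProbabilityMeasure P] {n : ℕ}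
  {p θ : ℝ} {φ : ℝ → ℝ} {U : Fin n → Ω → ℝ} {β : Ω → Fin n → ℝ}

theorem cdfPath_eq_interpPath_clampExtend {u : Fin n → ℝ} (hu : IsKnots (sortedKnots u))
    (z : Fin n → ℝ) :
    interpPath (fun j => clampExtend (warpInv φ) (sortedKnots u j)) (cdfJumps p z)
      = cdfPath p φ u z := by
  unfold cdfPath
  congr 1
  ext j
  exact clampExtend_of_mem (hu.mem_Icc j)

theorem IsCDFSample.map_prodMk [SFinite (dirichletMeasure fun _ : Fin n => θ / n)]
    (h : IsCDFSample P θ U β) :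
    (P.map fun ω => (sortedKnots fun i => U i ω, β ω))
      = (P.map fun ω => sortedKnots fun i => U i ω)
        ⊗ₘ Kernel.const _ (dirichletMeasure fun _ : Fin n => θ / n) := by
  rw [(indepFun_iff_map_prod_eq_prod_map_map (aemeasurable_sortedKnots h.uniform)
    h.dirichlet.aemeasurable).mp h.indep_dirichlet, h.dirichlet.map_eq, Measure.compProd_const]

theorem isProbabilityMeasure_dirichletMeasure_const (hθ : 0 < θ) (hn0 : 0 < n) :
    IsProbabilityMeasure (dirichletMeasure fun _ : Fin n => θ / n) :=
  isProbabilityMeasure_dirichletMeasure fun _ => div_pos hθ (by exact_mod_cast hn0)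

theorem IsCDFSample.memLp_and_integrable (h : IsCDFSample P θ U β)
    (hp : p ∈ Set.Ioo (0 : ℝ) 1) (hθ : 0 < θ) (hφ : IsACWarping φ) (hn0 : 0 < n) :
    (∀ᵐ ω ∂P, MemLp (fun t => cdfPath p φ (fun i => U i ω) (β ω) t - φ t) 2
      (volume.restrict (Set.Icc (0 : ℝ) 1))) ∧
    Integrable (fun ω => l2NormSq fun t => cdfPath p φ (fun i => U i ω) (β ω) t - φ t) P := by
  have : NeZero n := ⟨hn0.ne'⟩
  have := isProbabilityMeasure_dirichletMeasure_const hθ hn0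
  obtain ⟨h1, h2⟩ := (isPathScheme_cdf hp hθ hφ hn0).memLp_and_integrable h.indep h.uniform
    h.dirichlet.aemeasurable h.map_prodMk (ae_of_all _ fun x => Kernel.const_apply _ x)
    hφ.continuous_clampExtend hφ.clampExtend_mem_Icc
  simp only [l2NormSq_sub_clampExtend] at h2
  have hk := ae_isKnots_sortedKnots h.indep h.uniform
  constructor
  · filter_upwards [h1, hk] with ω hω hkω
    rw [cdfPath_eq_interpPath_clampExtend hkω] at hω
    exact memLp_sub_clampExtend hω
  · refine h2.congr ?_
    filter_upwards [hk] with ω hkω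
    rw [cdfPath_eq_interpPath_clampExtend hkω]

theorem IsCDFSample.abs_risk_sub_le (h : IsCDFSample P θ U β)
    (hp : p ∈ Set.Ioo (0 : ℝ) 1) (hθ : 0 < θ) (hφ : IsACWarping φ) (hn0 : 0 < n) {ε : ℝ}
    (hε : 0 < ε) {K : ℕ} (hK : 2 < ε * K) (hn : 1 ≤ ε * n) :
    |∫ ω, (l2NormSq fun t => cdfPath p φ (fun i => U i ω) (β ω) t - φ t) ∂P
      - 1 / (1 + θ) * ∫ t in (0 : ℝ)..1, φ t * (1 - φ t)|
      ≤ 5 * (2 * ε) + (K + 1) * (n / (n * (ε / 2)) ^ 2) := by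
  have : NeZero n := ⟨hn0.ne'⟩
  have := isProbabilityMeasure_dirichletMeasure_const hθ hn0
  have hmain := (isPathScheme_cdf hp hθ hφ hn0).abs_risk_sub_le h.indep h.uniform
    h.dirichlet.aemeasurable h.map_prodMk (ae_of_all _ fun x => Kernel.const_apply _ x)
    hφ.continuous_clampExtend hφ.clampExtend_mem_Icc hθ (δ := 2 * ε) (by positivity) hK hn
    fun x hx hxε t ht => cdf_path_close hp hθ hφ hn0 hn hx hxε ht
  simp only [l2NormSq_sub_clampExtend, integral_clampExtend_mul] at hmain
  rwa [integral_congr_ae (g := fun ω =>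
    l2NormSq fun t => cdfPath p φ (fun i => U i ω) (β ω) t - φ t)] at hmain
  filter_upwards [ae_isKnots_sortedKnots h.indep h.uniform] with ω hkω
  rw [cdfPath_eq_interpPath_clampExtend hkω]

end CDF

theorem exists_nat_two_lt_mul {ε : ℝ} (hε : 0 < ε) : ∃ K : ℕ, 2 < ε * K := by
  obtain ⟨K, hK⟩ := exists_nat_gt (2 / ε)
  rw [div_lt_iff₀ hε] at hK
  exact ⟨K, by linarith⟩

theorem IsACWarping.exists_modulus {φ : ℝ → ℝ} (hφ : IsACWarping φ) {η : ℝ} (hη : 0 < η) :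
    ∃ ε > 0, ∀ s ∈ Set.Icc (0 : ℝ) 1, ∀ t ∈ Set.Icc (0 : ℝ) 1,
      |s - t| ≤ 3 * ε → |φ s - φ t| ≤ η := by
  obtain ⟨d, hd, h⟩ := Metric.uniformContinuousOn_iff.mp
    (isCompact_Icc.uniformContinuousOn_of_continuous hφ.continuousOn) η hη
  -- `3 d / 4 < d` supplies the strict inequality.
  refine ⟨d / 4, by positivity, fun s hs t ht hst => ?_⟩
  have := h s hs t ht (by rw [Real.dist_eq]; linarith)
  rw [Real.dist_eq] at this
  exact this.le

theorem corollary1 (p θ : ℝ) (hp : p ∈ Set.Ioo (0 : ℝ) 1) (hθ : 0 < θ)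
    (φ : ℝ → ℝ) (hφ : IsACWarping φ) :
    (∀ (Ω : ℕ → Type*) [∀ n, MeasurableSpace (Ω n)]
      (P : ∀ n, Measure (Ω n)) [∀ n, IsProbabilityMeasure (P n)]
      (U : ∀ n, Fin n → Ω n → ℝ) (α : ∀ n, Ω n → Fin (n + 1) → ℝ),
      (∀ n, 1 ≤ n → IsBKSample (P n) θ φ (U n) (α n)) →
        (∀ n, 1 ≤ n →
          (∀ᵐ ω ∂(P n), MemLp (fun t => bkPath (fun i => U n i ω) (α n ω) t - φ t) 2
            (volume.restrict (Set.Icc (0 : ℝ) 1))) ∧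
          Integrable
            (fun ω => l2NormSq fun t => bkPath (fun i => U n i ω) (α n ω) t - φ t) (P n)) ∧
        Tendsto
          (fun n => ∫ ω, (l2NormSq fun t => bkPath (fun i => U n i ω) (α n ω) t - φ t) ∂(P n))
          atTop (𝓝 (1 / (1 + θ) * ∫ t in (0 : ℝ)..1, φ t * (1 - φ t)))) ∧
    (∀ (Ω : ℕ → Type*) [∀ n, MeasurableSpace (Ω n)]
      (P : ∀ n, Measure (Ω n)) [∀ n, IsProbabilityMeasure (P n)]
      (U : ∀ n, Fin n → Ω n → ℝ) (β : ∀ n, Ω n → Fin n → ℝ),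
      (∀ n, 1 ≤ n → IsCDFSample (P n) θ (U n) (β n)) →
        (∀ n, 1 ≤ n →
          (∀ᵐ ω ∂(P n), MemLp (fun t => cdfPath p φ (fun i => U n i ω) (β n ω) t - φ t) 2
            (volume.restrict (Set.Icc (0 : ℝ) 1))) ∧
          Integrable
            (fun ω => l2NormSq fun t => cdfPath p φ (fun i => U n i ω) (β n ω) t - φ t) (P n)) ∧
        Tendsto
          (fun n => ∫ ω,
            (l2NormSq fun t => cdfPath p φ (fun i => U n i ω) (β n ω) t - φ t) ∂(P n))
          atTop (𝓝 (1 / (1 + θ) * ∫ t in (0 : ℝ)..1, φ t * (1 - φ t)))) := by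
  refine ⟨fun Ω _ P _ U α h => ⟨fun n hn => (h n hn).memLp_and_integrable hθ hφ, ?_⟩,
    fun Ω _ P _ U β h => ⟨fun n hn => (h n hn).memLp_and_integrable hp hθ hφ hn, ?_⟩⟩
  · refine tendsto_of_forall_abs_sub_le fun η hη => ?_
    obtain ⟨ε, hε, hmod⟩ := hφ.exists_modulus hη
    obtain ⟨K, hK⟩ := exists_nat_two_lt_mul hε
    exact ⟨K + 1, ε, hε, fun n hn hεn => (h n hn).abs_risk_sub_le hθ hφ hη.le hmod hK hεn hn⟩
  · refine tendsto_of_forall_abs_sub_le fun η hη => ?_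
    obtain ⟨K, hK⟩ := exists_nat_two_lt_mul (half_pos hη)
    refine ⟨K + 1, η / 2, half_pos hη, fun n hn hεn => ?_⟩
    have := (h n hn).abs_risk_sub_le hp hθ hφ hn (half_pos hη) hK hεn
    rwa [mul_div_cancel₀ η two_ne_zero] at this
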